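/- **Setting.** Let $Q(x,u,v,y;\alpha,\beta)$ be one of the canonical polynomials of the ABS list (all parameters complex): - Q1($\delta$): $\alpha(x-v)(u-y)-\beta(x-u)(v-y)+\delta^2\alpha\beta(\alpha-\beta)$ - Q2: $\alpha(x-v)(u-y)-\beta(x-u)(v-y)+\alpha\beta(\alpha-\beta)(x+u+v+y)-\alpha\beta(\alpha-\beta)(\alpha^2-\alpha\beta+\beta^2)$ - Q3($\delta$): $\sinh\alpha\,(xu+vy)-\sinh\beta\,(xv+uy)-\sinh(\alpha-\beta)(xy+uv)+\delta\sinh(\alpha-\beta)\sinh\alpha\sinh\beta$ - Q4: $\mathrm{sn}\,\alpha\,(xu+vy)-\mathrm{sn}\,\beta\,(xv+uy)-\mathrm{sn}(\alpha-\beta)(xy+uv)+\mathrm{sn}(\alpha-\beta)\,\mathrm{sn}\,\alpha\,\mathrm{sn}\,\beta\,(1+k^2xuvy)$, where $\mathrm{sn}$ is the Jacobi elliptic function of modulus $k=\theta_2(0|\tau)^2/\theta_3(0|\tau)^2$, $\operatorname{Im}\tau>0$ (every $k\ne0,\pm1$ is of this form) - H1: $(x-y)(u-v)+\beta-\alpha$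 - H2: $(x-y)(u-v)+(\beta-\alpha)(x+u+v+y)+\beta^2-\alpha^2$ - H3($\delta$): $e^\alpha(xu+vy)-e^\beta(xv+uy)+\delta(e^{2\alpha}-e^{2\beta})$ - A1($\delta$): $\alpha(x+v)(u+y)-\beta(x+u)(v+y)-\delta^2\alpha\beta(\alpha-\beta)$ - A2: $\sinh\alpha\,(xv+uy)-\sinh\beta\,(xu+vy)-\sinh(\alpha-\beta)(1+xuvy)$ Its tetrahedron equation $Q^\intercal=0$ is the same equation for Q1($\delta$), Q2, Q3($\delta$), Q4; it is Q1($0$) for H1, Q1($1$) for H2, Q3($0$) for H3($\delta$), Q1($\delta$) for A1($\delta$), and Q3($0$) for A2. A pair $(\alpha,\beta)$ is *admissible* if the coefficients of $Q(\cdot;\alpha,\beta)$ are finite and $Q(\cdot;\alpha,\beta)$ is irreducible. A *boundary polynomial* is a family $q(x,y,z;\alpha,\beta)$ that, for all admissible $(\alpha,\beta)$, is irreducible in $x,y,z$, of degree one in $x$ and in $z$, and satisfies $q(x,y,z;\alpha,\beta)=\gamma\,q(z,y,x;\beta,\alpha)$ with a constant $\gamma\in\{1,-1\}$. Boundary polynomials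 $q,p$ are *dual* if for some polynomials $\chi(x,u;\alpha,\beta)$ and all admissible $(\alpha,\beta)$ $$Q\,q_y-Q_y\,q=\chi(x,u;\alpha,\beta)\,p(u,x,v;\alpha,\beta),\qquad Q=Q(x,u,v,y;\alpha,\beta),\quad q=q(x,u,y;\alpha,\beta).$$ The equation $q=0$ is *nondegenerate* if for all admissible $(\alpha,\beta)$: (i) $q(x,u,y)=0$ does not imply $QQ_{uv}-Q_uQ_v=0$; (ii) $q(x,u,y)$ is not of the form $c_1S+c_0T$ with constants $c_0,c_1$, where $Q=S+Tv$ with $S,T$ independent of $v$. Let $\sigma$ be an involution of the parameters. The equation $q=0$ is *boundary consistent with $Q=0$ with involution relation $\sigma$* if it is nondegenerate and the following holds whenever, with $\beta=\sigma(\alpha)$ and $\eta=\sigma(\lambda)$, all six pairs $(\alpha,\lambda),(\beta,\lambda),(\alpha,\eta),(\beta,\eta),(\alpha,\beta),(\lambda,\eta)$ are admissible. For generic $x,y,u$ (outside the zero set of a nonzero polynomial) the equations $$q(x,y,z;\alpha,\beta)=0,\quad q(x,u,r;\lambda,\eta)=0,\quad Q(x,y,u,v;\alpha,\lambda)=0,\quad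 Q(y,z,v,w;\beta,\lambda)=0,\quad Q(u,v,r,s;\alpha,\eta)=0$$ successively determine unique values $z,r,v,w,s$, and each of the three equations $$Q(v,w,s,t;\beta,\eta)=0,\qquad q(r,s,t;\alpha,\beta)=0,\qquad q(z,w,t;\lambda,\eta)=0$$ has a unique solution $t$, the same one for all three. A family $q$ (and likewise $p$) is *in the $\mathcal M_+$ case* with constants $r_1,r_2,r_4\in\mathbb C$ independent of the lattice parameters, $r_1r_4-r_2^2\ne0$, if $q(x,y,z;\alpha,\beta)=r_1xz+r_2x+r_2z+r_4$, and *in the $\mathcal M_-$ case* if $q(x,y,z;\alpha,\beta)=x-z$ (for admissible $(\alpha,\beta)$). The associated Möbius maps are $\mathfrak m^+(x)=-\dfrac{r_2x+r_4}{r_1x+r_2}$ and $\mathfrak m^-(x)=x$. A Möbius map is a *symmetry* of $Q^\intercal=0$ if, applied simultaneously to all four arguments, it maps solutions to solutions, for all parameters admissible for $Q^\intercal$. **Theorem.** Let $Q$ be in the ABS list, let $q,p$ be a pair of dual boundary polynomials of $Q$, and let $\mu\in\mathbb C$ be arbitrary. Then $q=0$ is boundary consistent with $Q=0$ with involution relation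 $\sigma(\alpha)=-\alpha+\mu$ in each of the following two cases: 1. (Möbius case I) $q$ is in the $\mathcal M_+$ or the $\mathcal M_-$ case; 2. (Möbius case II) $p$ is in the $\mathcal M_+$ or the $\mathcal M_-$ case, and the associated Möbius map $\mathfrak m^\pm$ is a symmetry of the tetrahedron equation $Q^\intercal=0$. -/

import Mathlib

namespace QuadGraph

noncomputable section

open MvPolynomial

/-! ### The Jacobi elliptic function `sn`

The four Jacobi theta functions in the classical normalisation, with nome `exp (π i τ)`:
`θ₃ z = ∑ exp (π i τ n² + 2 i n z)`, and the other three are its translates by half periods. -/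

/-- `θ₁ (z | τ)`. -/
def theta1 (τ z : ℂ) : ℂ :=
  -Complex.I * Complex.exp (Real.pi * Complex.I * τ / 4 + Complex.I * z) *
    jacobiTheta₂ (z / Real.pi + 1 / 2 + τ / 2) τ

/-- `θ₂ (z | τ)`. -/
def theta2 (τ z : ℂ) : ℂ :=
  Complex.exp (Real.pi * Complex.I * τ / 4 + Complex.I * z) *
    jacobiTheta₂ (z / Real.pi + τ / 2) τ

/-- `θ₃ (z | τ)`. -/
def theta3 (τ z : ℂ) : ℂ := jacobiTheta₂ (z / Real.pi) τ

/-- `θ₄ (z | τ)`. -/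
def theta4 (τ z : ℂ) : ℂ := jacobiTheta₂ (z / Real.pi + 1 / 2) τ

/-- The elliptic modulus `k = θ₂(0)² / θ₃(0)²`; it takes every value other than `0, 1, -1` as `τ`
runs through the upper half plane. -/
def ellipticModulus (τ : ℂ) : ℂ := theta2 τ 0 ^ 2 / theta3 τ 0 ^ 2

/-- The Jacobi elliptic function `sn` of modulus `ellipticModulus τ`:
`sn a = (θ₃(0) / θ₂(0)) * (θ₁ z / θ₄ z)` with `z = a / θ₃(0)²`. -/
def jacobiSn (τ a : ℂ) : ℂ :=
  theta3 τ 0 / theta2 τ 0 *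
    (theta1 τ (a / theta3 τ 0 ^ 2) / theta4 τ (a / theta3 τ 0 ^ 2))

/-- `a` is not a pole of `sn`. -/
def SnFinite (τ a : ℂ) : Prop := theta4 τ (a / theta3 τ 0 ^ 2) ≠ 0

/-! ### The bulk polynomials of the ABS classification -/

/-- The equations of the ABS list. -/
inductive BulkType : Type
  | Q1 (δ : ℂ)
  | Q2
  | Q3 (δ : ℂ)
  | Q4 (τ : UpperHalfPlane)
  | H1
  | H2
  | H3 (δ : ℂ)
  | A1 (δ : ℂ)
  | A2

/-- The canonical bulk polynomial `Q(x, u, v, y; α, β)`; the variables `x, u, v, y` are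
`X 0, X 1, X 2, X 3`. -/
def BulkType.poly (E : BulkType) (α β : ℂ) : MvPolynomial (Fin 4) ℂ :=
  let x : MvPolynomial (Fin 4) ℂ := X 0
  let u : MvPolynomial (Fin 4) ℂ := X 1
  let v : MvPolynomial (Fin 4) ℂ := X 2
  let y : MvPolynomial (Fin 4) ℂ := X 3
  match E with
  | .Q1 δ =>
      C α * (x - v) * (u - y) - C β * (x - u) * (v - y) + C (δ ^ 2 * α * β * (α - β))
  | .Q2 =>
      C α * (x - v) * (u - y) - C β * (x - u) * (v - y)
        + C (α * β * (α - β)) * (x + u + v + y)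
        - C (α * β * (α - β) * (α ^ 2 - α * β + β ^ 2))
  | .Q3 δ =>
      C (Complex.sinh α) * (x * u + v * y) - C (Complex.sinh β) * (x * v + u * y)
        - C (Complex.sinh (α - β)) * (x * y + u * v)
        + C (δ * Complex.sinh (α - β) * Complex.sinh α * Complex.sinh β)
  | .Q4 τ =>
      C (jacobiSn τ α) * (x * u + v * y) - C (jacobiSn τ β) * (x * v + u * y)
        - C (jacobiSn τ (α - β)) * (x * y + u * v)
        + C (jacobiSn τ (α - β) * jacobiSn τ α * jacobiSn τ β)
          * (1 + C (ellipticModulus τ ^ 2) * x * u * v * y)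
  | .H1 => (x - y) * (u - v) + C (β - α)
  | .H2 => (x - y) * (u - v) + C (β - α) * (x + u + v + y) + C (β ^ 2 - α ^ 2)
  | .H3 δ =>
      C (Complex.exp α) * (x * u + v * y) - C (Complex.exp β) * (x * v + u * y)
        + C (δ * (Complex.exp (2 * α) - Complex.exp (2 * β)))
  | .A1 δ =>
      C α * (x + v) * (u + y) - C β * (x + u) * (v + y) - C (δ ^ 2 * α * β * (α - β))
  | .A2 =>
      C (Complex.sinh α) * (x * v + u * y) - C (Complex.sinh β) * (x * u + v * y)
        - C (Complex.sinh (α - β)) * (1 + x * u * v * y)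

/-- The value `Q(x, u, v, y; α, β)`. -/
def BulkType.Q (E : BulkType) (x u v y α β : ℂ) : ℂ := eval ![x, u, v, y] (E.poly α β)

/-- The tetrahedron equation `Qᵀ = 0`, an equation of Q-type. -/
def BulkType.tetrahedron : BulkType → BulkType
  | .Q1 δ => .Q1 δ
  | .Q2 => .Q2
  | .Q3 δ => .Q3 δ
  | .Q4 τ => .Q4 τ
  | .H1 => .Q1 0
  | .H2 => .Q1 1
  | .H3 _ => .Q3 0
  | .A1 δ => .Q1 δ
  | .A2 => .Q3 0

/-- The pair of lattice parameters is not a pole of the coefficients (only Q4 has poles). -/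
def BulkType.FiniteAt (E : BulkType) (α β : ℂ) : Prop :=
  match E with
  | .Q4 τ => SnFinite τ α ∧ SnFinite τ β ∧ SnFinite τ (α - β)
  | _ => True

/-- The pairs of lattice parameters for which `Q(·; α, β)` is a bulk polynomial: the coefficients
are finite and the polynomial is irreducible. -/
def BulkType.Regular (E : BulkType) (α β : ℂ) : Prop :=
  E.FiniteAt α β ∧ Irreducible (E.poly α β)

/-! ### Boundary polynomials and duality -/

/-- A polynomial in three arguments depending on two lattice parameters. -/
abbrev TriFamily : Type := ℂ → ℂ → MvPolynomial (Fin 3) ℂ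

/-- Boundary polynomials: irreducible, affine-linear in the first and third arguments,
and symmetric under their exchange together with that of the parameters, with parity `γ`. -/
def IsBoundaryPolynomial (E : BulkType) (q : TriFamily) : Prop :=
  (∀ α β, E.Regular α β →
    Irreducible (q α β) ∧ degreeOf 0 (q α β) = 1 ∧ degreeOf 2 (q α β) = 1) ∧
  ∃ γ : ℂ, (γ = 1 ∨ γ = -1) ∧
    ∀ α β, E.Regular α β → q α β = C γ * rename ![2, 1, 0] (q β α)

/-- `q(x, u, y)` as a polynomial in `x, u, v, y`. -/
def onXUY (q : MvPolynomial (Fin 3) ℂ) : MvPolynomial (Fin 4) ℂ := rename ![0, 1, 3] q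

/-- `p(u, x, v)` as a polynomial in `x, u, v, y`. -/
def onUXV (p : MvPolynomial (Fin 3) ℂ) : MvPolynomial (Fin 4) ℂ := rename ![1, 0, 2] p

/-- `H = Q q_y - Q_y q`, the result of eliminating `y` from `Q(x, u, v, y) = 0` and
`q(x, u, y) = 0`. -/
def eliminant (Q : MvPolynomial (Fin 4) ℂ) (q : MvPolynomial (Fin 3) ℂ) :
    MvPolynomial (Fin 4) ℂ :=
  Q * pderiv 3 (onXUY q) - pderiv 3 Q * onXUY q

/-- `q, p` is a pair of dual boundary polynomials of `Q`:
`Q q_y - Q_y q = χ(x, u; α, β) p(u, x, v; α, β)`. -/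
def IsDualPair (E : BulkType) (q p : TriFamily) : Prop :=
  IsBoundaryPolynomial E q ∧ IsBoundaryPolynomial E p ∧
  ∃ χ : ℂ → ℂ → MvPolynomial (Fin 2) ℂ, ∀ α β, E.Regular α β →
    eliminant (E.poly α β) (q α β) = rename ![0, 1] (χ α β) * onUXV (p α β)

/-- `δ_{u,v} Q = Q Q_{uv} - Q_u Q_v`. -/
def deltaUV (Q : MvPolynomial (Fin 4) ℂ) : MvPolynomial (Fin 4) ℂ :=
  Q * pderiv 1 (pderiv 2 Q) - pderiv 1 Q * pderiv 2 Q

/-- `q = 0` leads to `δ_{u,v} Q = 0`, hence to solutions of `Q = 0` which are singular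
with respect to `u` or `v`. -/
def DegenerateI (Q : MvPolynomial (Fin 4) ℂ) (q : MvPolynomial (Fin 3) ℂ) : Prop :=
  ∀ x u v y : ℂ, eval ![x, u, y] q = 0 → eval ![x, u, v, y] (deltaUV Q) = 0

/-- `q` is a linear combination of `S` and `T`, where `Q = S + T v` with `S, T` not involving `v`:
then `q = 0` leads to `S = T = 0` or to a fixed value of `v`. -/
def DegenerateII (Q : MvPolynomial (Fin 4) ℂ) (q : MvPolynomial (Fin 3) ℂ) : Prop :=
  ∃ c₀ c₁ : ℂ, onXUY q = C c₁ * (Q - pderiv 2 Q * X 2) + C c₀ * pderiv 2 Q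

/-- The boundary equation `q = 0` is nondegenerate for `Q = 0`. -/
def Nondegenerate (E : BulkType) (q : TriFamily) : Prop :=
  ∀ α β, E.Regular α β →
    ¬ DegenerateI (E.poly α β) (q α β) ∧ ¬ DegenerateII (E.poly α β) (q α β)

/-! ### Boundary consistency on half of a rhombic dodecahedron -/

/-- `a` is the one and only solution of `f = 0`. -/
def IsUniqueZero (f : ℂ → ℂ) (a : ℂ) : Prop := ∀ b, f b = 0 ↔ b = a

/-- The value `q(x, y, z; α, β)`. -/
def TriFamily.val (q : TriFamily) (x y z α β : ℂ) : ℂ := eval ![x, y, z] (q α β)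

/-- The initial value problem on half of a rhombic dodecahedron: for generic initial values
`x, y, u` (off the zero set of a nonzero polynomial), the values `z, r, v, w, s` are determined
successively, and the last value is determined in each of the three possible ways, with the
same result `t`. The parameters `α, β, l, η` sit on the edges `xy, yz, xu, ur`. -/
def HalfDodecahedronWellPosed (E : BulkType) (q : TriFamily) (α β l η : ℂ) : Prop :=
  ∃ D : MvPolynomial (Fin 3) ℂ, D ≠ 0 ∧ ∀ x y u : ℂ, eval ![x, y, u] D ≠ 0 →
    ∃ z r v w s t : ℂ,
      IsUniqueZero (fun z' => q.val x y z' α β) z ∧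
      IsUniqueZero (fun r' => q.val x u r' l η) r ∧
      IsUniqueZero (fun v' => E.Q x y u v' α l) v ∧
      IsUniqueZero (fun w' => E.Q y z v w' β l) w ∧
      IsUniqueZero (fun s' => E.Q u v r s' α η) s ∧
      IsUniqueZero (fun t' => E.Q v w s t' β η) t ∧
      IsUniqueZero (fun t' => q.val r s t' α β) t ∧
      IsUniqueZero (fun t' => q.val z w t' l η) t

/-- `q = 0` is boundary consistent with `Q = 0` with involution relation `σ`: `q = 0` is
nondegenerate and, with `β = σ α` and `η = σ l`, the initial value problem on half of a rhombic
dodecahedron is well-posed whenever each two of the four parameters are admissible for `Q`. -/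
def BoundaryConsistent (E : BulkType) (q : TriFamily) (σ : ℂ → ℂ) : Prop :=
  Function.Involutive σ ∧ Nondegenerate E q ∧
  ∀ α l : ℂ,
    E.Regular α l → E.Regular (σ α) l → E.Regular α (σ l) → E.Regular (σ α) (σ l) →
    E.Regular α (σ α) → E.Regular l (σ l) →
    HalfDodecahedronWellPosed E q α (σ α) l (σ l)

/-! ### The Möbius case -/

/-- The cases `M₊` (with constants `r₁, r₂, r₄`) and `M₋`. -/
inductive MobiusForm : Type
  | plus (r₁ r₂ r₄ : ℂ) (h : r₁ * r₄ - r₂ ^ 2 ≠ 0)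
  | minus

/-- The boundary polynomial `r₁ x y + r₂ x + r₂ y + r₄`, respectively `x - y`, in which `x, y` are
the first and third arguments. -/
def MobiusForm.poly : MobiusForm → MvPolynomial (Fin 3) ℂ
  | .plus r₁ r₂ r₄ _ => C r₁ * X 0 * X 2 + C r₂ * X 0 + C r₂ * X 2 + C r₄
  | .minus => X 0 - X 2

/-- The matrix of the associated Möbius transformation `x ↦ -(r₂ x + r₄) / (r₁ x + r₂)`,
respectively `x ↦ x`. -/
def MobiusForm.matrix : MobiusForm → Matrix (Fin 2) (Fin 2) ℂ
  | .plus r₁ r₂ r₄ _ => !![-r₂, -r₄; r₁, r₂]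
  | .minus => 1

/-- `q` is in the case `M` for all admissible pairs of lattice parameters. -/
def MobiusForm.Has (M : MobiusForm) (E : BulkType) (q : TriFamily) : Prop :=
  ∀ α β, E.Regular α β → q α β = M.poly

/-- The Möbius transformation with matrix `A`, used where the denominator is nonzero. -/
def mobius (A : Matrix (Fin 2) (Fin 2) ℂ) (x : ℂ) : ℂ :=
  (A 0 0 * x + A 0 1) / (A 1 0 * x + A 1 1)

/-- The Möbius transformation with matrix `A` is a symmetry of the equation `Q = 0`: applied to all
four arguments, it maps solutions to solutions. -/
def IsMobiusSymmetry (E : BulkType) (A : Matrix (Fin 2) (Fin 2) ℂ) : Prop :=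
  A.det ≠ 0 ∧ ∀ α β, E.Regular α β → ∀ x u v y : ℂ,
    A 1 0 * x + A 1 1 ≠ 0 → A 1 0 * u + A 1 1 ≠ 0 →
    A 1 0 * v + A 1 1 ≠ 0 → A 1 0 * y + A 1 1 ≠ 0 →
    E.Q x u v y α β = 0 →
    E.Q (mobius A x) (mobius A u) (mobius A v) (mobius A y) α β = 0

end

end QuadGraph

namespace QuadGraph

noncomputable section

open MvPolynomial

/-! ### Affine-linear multivariate polynomials -/

section Affine

variable {σ : Type*}

/-! Nondegeneracy follows from duality alone (`nondegenerate_of_isDualPair`). The discriminant of `H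
= Q q_y - Q_y q = χ p` with respect to `u, v` is `χ²` times that of `p`. It is nonzero because `p`
is irreducible and involves both variables, and it is free of `y`. Each kind of degeneracy would
make it vanish identically.

Well-posedness rests on the tetrahedron property `exists_affRes_tetrahedron`. Eliminating the common
edge of two faces at a vertex gives, up to nonzero factors, the same resultant as eliminating a
vertex between a third face there and an equation `Qᵀ = 0`. It is an identity of affine-linear
resultants, which reduces to addition theorems for `sinh` and `sn`. The latter are derived from
bilinear theta identities. The involution enters only through `α + β = l + η`, both sums being `μ`.

In case I the boundary equation relates only the outer vertices, by an involutive Möbius map. Hence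
`r = z`, and `t = x` solves both final boundary equations. The remaining bulk equation closes a ring
of four faces around `v` (`Q_eq_zero_of_four_faces`). The two pairs of faces lead to the same
tetrahedron equation, because `α - η = -(β - l)` and `β - η = -(α - l)`.

In case II a solution of `q(x, u, y) = 0` gives a face `Q(x, u, n, y) = 0`, where `n` is the Möbius
image of `u` (`IsDualPair.Q_eq_zero`). Thus boundary equations become bulk equations with reflected
vertices, and `Q_eq_zero_of_mobius` combines three ingredients: the tetrahedron property, the
assumed symmetry of `Qᵀ`, and an exchange of opposite vertices in a resultant of two tetrahedron
equations (`affRes_symm_of_involution`). The same lemma with the two parameter pairs interchanged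
treats the other boundary equation. Uniqueness of the last bulk vertex identifies the two values of
`t`.

Divisions by vanishing slopes are excluded generically. Irreducibility makes the relevant
discriminants nonzero, and each step determining a new vertex is birational (`Generically.step`), so
nonvanishing conditions at later vertices pull back to nonzero polynomials in the initial values. -/

theorem pderiv_eq_zero_iff_degreeOf {i : σ} {f : MvPolynomial σ ℂ} :
    pderiv i f = 0 ↔ degreeOf i f = 0 := by
  classical
  constructor
  · intro h
    rw [← Nat.le_zero, degreeOf_le_iff]
    intro m hm
    by_contra hmi
    have hpos : 0 < m i := by omega
    have hc := coeff_pderiv (i := i) f (m - Finsupp.single i 1)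
    rw [h, coeff_zero] at hc
    have hle : Finsupp.single i 1 ≤ m := by
      rw [Finsupp.single_le_iff]; omega
    rw [tsub_add_cancel_of_le hle] at hc
    rcases mul_eq_zero.1 hc.symm with h0 | h0
    · exact (mem_support_iff.1 hm) h0
    · exact absurd h0 (Nat.cast_add_one_ne_zero _)
  · intro h
    refine pderiv_eq_zero_of_notMem_vars fun hi => ?_
    exact (mem_vars_iff_degreeOf_ne_zero.1 hi) h

theorem pderiv_comm (i j : σ) (f : MvPolynomial σ ℂ) :
    pderiv i (pderiv j f) = pderiv j (pderiv i f) := by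
  classical
  by_cases hij : i = j
  · rw [hij]
  ext m
  simp only [coeff_pderiv, Finsupp.add_apply, Finsupp.single_apply, hij, Ne.symm hij, if_false,
    add_zero]
  rw [add_right_comm]
  ring

theorem pderiv_pderiv_of_degreeOf_le_one {i : σ} {f : MvPolynomial σ ℂ} (h : degreeOf i f ≤ 1) :
    pderiv i (pderiv i f) = 0 := by
  classical
  ext m
  rw [coeff_pderiv, coeff_pderiv, coeff_zero]
  have : coeff (m + Finsupp.single i 1 + Finsupp.single i 1) f = 0 := by
    by_contra hne
    have := degreeOf_le_iff.1 h _ (mem_support_iff.2 hne)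
    simp at this
  rw [this]; ring

theorem eval_update_of_pderiv_eq_zero [DecidableEq σ] {i : σ} {f : MvPolynomial σ ℂ}
    (h : pderiv i f = 0) (p : σ → ℂ) (t : ℂ) :
    eval (Function.update p i t) f = eval p f := by
  refine eval₂Hom_congr' rfl (fun j hj _ => ?_) rfl
  have : j ≠ i := by
    rintro rfl
    exact mem_vars_iff_degreeOf_ne_zero.1 hj (pderiv_eq_zero_iff_degreeOf.1 h)
  simp [Function.update_of_ne this]

theorem eval_update_of_affine [DecidableEq σ] {i : σ} {f : MvPolynomial σ ℂ}
    (h : pderiv i (pderiv i f) = 0) (p : σ → ℂ) (t : ℂ) :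
    eval (Function.update p i t) f = eval p f + (t - p i) * eval p (pderiv i f) := by
  have h1 : pderiv i (f - X i * pderiv i f) = 0 := by
    rw [map_sub, pderiv_mul, pderiv_X_self, h]; ring
  have e : f = (f - X i * pderiv i f) + X i * pderiv i f := by ring
  have e1 := eval_update_of_pderiv_eq_zero h1 p t
  have e2 := eval_update_of_pderiv_eq_zero h p t
  simp only [map_sub, map_mul, eval_X, Function.update_self, e2] at e1
  linear_combination e1

theorem pderiv_eq_zero_of_mul_left {i : σ} {f g : MvPolynomial σ ℂ} (hf : f ≠ 0)
    (h : pderiv i (f * g) = 0) : pderiv i g = 0 := by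
  by_cases hg : g = 0
  · rw [hg, map_zero]
  rw [pderiv_eq_zero_iff_degreeOf, degreeOf_mul_eq hf hg] at h
  rw [pderiv_eq_zero_iff_degreeOf]
  omega

/-- An irreducible polynomial that involves two variables, and is affine-linear in each, is
nonsingular with respect to them. -/
theorem discr_ne_zero_of_irreducible {i j : σ} (hij : i ≠ j) {f : MvPolynomial σ ℂ}
    (hf : Irreducible f) (hii : pderiv i (pderiv i f) = 0) (hjj : pderiv j (pderiv j f) = 0)
    (hi : pderiv i f ≠ 0) (hj : pderiv j f ≠ 0) :
    f * pderiv i (pderiv j f) - pderiv i f * pderiv j f ≠ 0 := by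
  classical
  intro h0
  have Xij : pderiv i (X j : MvPolynomial σ ℂ) = 0 := pderiv_X_of_ne hij.symm
  have Xji : pderiv j (X i : MvPolynomial σ ℂ) = 0 := pderiv_X_of_ne hij
  set d := pderiv i (pderiv j f) with hd
  have hd' : pderiv j (pderiv i f) = d := (pderiv_comm i j f).symm
  have hdi : pderiv i d = 0 := by rw [← hd', pderiv_comm i j, hii, map_zero]
  have hdj : pderiv j d = 0 := by rw [hd, pderiv_comm j i, hjj, map_zero]
  -- Write `f = a + b X_i + c X_j + d X_i X_j` with coefficients free of both variables. The
  -- discriminant is then `a d - b c`.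
  obtain ⟨b, hb⟩ : ∃ b, b = pderiv i f - X j * d := ⟨_, rfl⟩
  obtain ⟨c, hc⟩ : ∃ c, c = pderiv j f - X i * d := ⟨_, rfl⟩
  obtain ⟨a, ha⟩ : ∃ a, a = f - X i * pderiv i f - X j * pderiv j f + X i * X j * d := ⟨_, rfl⟩
  have hbi : pderiv i b = 0 := by rw [hb, map_sub, pderiv_mul, hii, Xij, hdi]; ring
  have hbj : pderiv j b = 0 := by rw [hb, map_sub, pderiv_mul, hd', pderiv_X_self, hdj]; ring
  have hci : pderiv i c = 0 := by rw [hc, map_sub, pderiv_mul, ← hd, pderiv_X_self, hdi]; ring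
  have hai : pderiv i a = 0 := by
    rw [ha]
    simp only [map_add, map_sub, pderiv_mul, hii, Xij, hdi, pderiv_X_self, ← hd]; ring
  have haj : pderiv j a = 0 := by
    rw [ha]
    simp only [map_add, map_sub, pderiv_mul, hjj, Xji, hdj, pderiv_X_self, hd']; ring
  have hfe : f = a + b * X i + c * X j + d * X i * X j := by rw [ha, hb, hc]; ring
  have had : a * d = b * c := by rw [ha, hb, hc]; linear_combination h0
  have hfi : pderiv i f = b + d * X j := by rw [hb]; ring
  have hfj : pderiv j f = c + d * X i := by rw [hc]; ring
  by_cases hb0 : b = 0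
  · rw [hb0, zero_mul] at had
    rcases mul_eq_zero.1 had with h | h
    · have hfac : f = X j * (c + d * X i) := by rw [hfe, h, hb0]; ring
      rcases hf.isUnit_or_isUnit hfac with hu | hu
      · rw [isUnit_iff_eq_C_of_isReduced] at hu
        obtain ⟨k, -, hk⟩ := hu
        have := congrArg (pderiv j) hk
        rw [pderiv_X_self, pderiv_C] at this
        exact one_ne_zero this
      · rw [isUnit_iff_eq_C_of_isReduced] at hu
        obtain ⟨k, -, hk⟩ := hu
        apply hi
        rw [hfac, hk, pderiv_mul, Xij, pderiv_C]; ring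
    · exact hi (by rw [hfi, hb0, h]; ring)
  -- Since `b` divides `a d`, unique factorisation splits it as `b₁ b₂` with `b₁ ∣ a` and `b₂ ∣ d`.
  -- This factors `f` into a part without `X_i` and a part without `X_j`.
  · obtain ⟨b₁, b₂, ⟨a', rfl⟩, ⟨d', hd2⟩, hbb⟩ :=
      exists_dvd_and_dvd_of_dvd_mul (Dvd.intro _ had.symm)
    have hb1 : b₁ ≠ 0 := by rintro rfl; exact hb0 (by rw [hbb, zero_mul])
    have hb2 : b₂ ≠ 0 := by rintro rfl; exact hb0 (by rw [hbb, mul_zero])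
    have hca : c = a' * d' := by
      apply mul_left_cancel₀ hb0
      rw [← had, hd2, hbb]; ring
    have hfac : f = (b₁ + d' * X j) * (a' + b₂ * X i) := by
      rw [hfe, hca, hd2, hbb]; ring
    rcases hf.isUnit_or_isUnit hfac with hu | hu
    · rw [isUnit_iff_eq_C_of_isReduced] at hu
      obtain ⟨k, -, hk⟩ := hu
      apply hj
      have h1 : pderiv j a' = 0 := pderiv_eq_zero_of_mul_left hb1 haj
      have h2 : pderiv j b₂ = 0 := pderiv_eq_zero_of_mul_left hb1 (hbb ▸ hbj)
      rw [hfac, hk, pderiv_mul, pderiv_C, map_add, pderiv_mul, h1, h2, Xji]; ring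
    · rw [isUnit_iff_eq_C_of_isReduced] at hu
      obtain ⟨k, -, hk⟩ := hu
      apply hi
      have h1 : pderiv i b₁ = 0 :=
        pderiv_eq_zero_of_mul_left hb2 (by rw [mul_comm, ← hbb]; exact hbi)
      have h2 : pderiv i d' = 0 := pderiv_eq_zero_of_mul_left hb2 (hd2 ▸ hdi)
      rw [hfac, hk, pderiv_mul, pderiv_C, map_add, pderiv_mul, h1, h2, Xij]; ring

theorem isUnit_of_pderiv_eq_zero {f : MvPolynomial σ ℂ} (hf : f ≠ 0)
    (h : ∀ i, pderiv i f = 0) : IsUnit f := by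
  have hv : f.vars = ∅ := by
    rw [Finset.eq_empty_iff_forall_notMem]
    intro i hi
    exact mem_vars_iff_degreeOf_ne_zero.1 hi (pderiv_eq_zero_iff_degreeOf.1 (h i))
  rw [isUnit_iff_eq_C_of_isReduced]
  rw [vars_eq_empty_iff_eq_C] at hv
  refine ⟨coeff 0 f, ?_, hv⟩
  rw [isUnit_iff_ne_zero]
  intro h0
  rw [h0, C_0] at hv
  exact hf hv

/-- A polynomial that is affine-linear in all variables, and nonsingular with respect to each two
of them, is irreducible. -/
theorem irreducible_of_discr_ne_zero [Nontrivial σ] {f : MvPolynomial σ ℂ}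
    (hdeg : ∀ i, degreeOf i f ≤ 1)
    (h : ∀ i j, i ≠ j → f * pderiv i (pderiv j f) - pderiv i f * pderiv j f ≠ 0) :
    Irreducible f := by
  have hfi : ∀ i, pderiv i f ≠ 0 := by
    intro i hi
    obtain ⟨j, hj⟩ := exists_ne i
    apply h j i hj
    rw [hi]; simp
  have hf0 : f ≠ 0 := by
    obtain ⟨i, -⟩ := exists_pair_ne σ
    rintro rfl
    exact hfi i (map_zero _)
  refine ⟨fun hu => ?_, fun g k hgk => ?_⟩
  · rw [isUnit_iff_eq_C_of_isReduced] at hu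
    obtain ⟨c, -, rfl⟩ := hu
    obtain ⟨i, -⟩ := exists_pair_ne σ
    exact hfi i pderiv_C
  · have hg0 : g ≠ 0 := by rintro rfl; exact hf0 (by rw [hgk, zero_mul])
    have hk0 : k ≠ 0 := by rintro rfl; exact hf0 (by rw [hgk, mul_zero])
    have hor : ∀ i, pderiv i g = 0 ∨ pderiv i k = 0 := by
      intro i
      have := hdeg i
      rw [hgk, degreeOf_mul_eq hg0 hk0] at this
      rw [pderiv_eq_zero_iff_degreeOf, pderiv_eq_zero_iff_degreeOf]
      omega
    by_cases hg : ∀ i, pderiv i g = 0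
    · exact Or.inl (isUnit_of_pderiv_eq_zero hg0 hg)
    · push Not at hg
      obtain ⟨i, hi⟩ := hg
      refine Or.inr (isUnit_of_pderiv_eq_zero hk0 fun j => ?_)
      have hki := (hor i).resolve_left hi
      by_contra hj
      -- If `g` involves `i` and `k` involves `j`, then neither involves the other variable, and
      -- both terms of the discriminant of `g k` equal `g k g_i k_j`.
      have hgj := (hor j).resolve_right hj
      have hij : i ≠ j := by rintro rfl; exact hi hgj
      apply h i j hij
      rw [hgk]
      simp only [pderiv_mul, hki, hgj, mul_zero, zero_mul, add_zero, zero_add]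
      rw [pderiv_comm i j k, hki, map_zero]
      ring

end Affine

/-! ### Theta functions and the Jacobi function `sn` -/

theorem hasSum_mul_prod {f g : ℤ → ℂ} {a b : ℂ} (hf : HasSum f a) (hg : HasSum g b) :
    HasSum (fun p : ℤ × ℤ => f p.1 * g p.2) (a * b) := by
  have hs : Summable fun p : ℤ × ℤ => f p.1 * g p.2 :=
    summable_mul_of_summable_norm hf.summable.norm hg.summable.norm
  exact hf.mul hg hs

/-- Multiply the two series and split the double sum by the parity of `m + n`. With `m = j + k, n =
j - k`, respectively `m = j + k + 1, n = j - k`, the quadratic form `m² + n²` becomes diagonal in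
`j, k` with twice the period. -/
theorem jacobiTheta₂_add_mul_sub {τ : ℂ} (hτ : 0 < τ.im) (a b : ℂ) :
    jacobiTheta₂ (a + b) τ * jacobiTheta₂ (a - b) τ =
      jacobiTheta₂ (2 * a) (2 * τ) * jacobiTheta₂ (2 * b) (2 * τ) +
      Complex.exp (2 * Real.pi * Complex.I * (a + b) + Real.pi * Complex.I * τ) *
        (jacobiTheta₂ (2 * a + τ) (2 * τ) * jacobiTheta₂ (2 * b + τ) (2 * τ)) := by
  have hτ2 : 0 < (2 * τ).im := by simpa using hτ
  have prod : ∀ {z w σ : ℂ}, 0 < σ.im → HasSum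
      (fun p : ℤ × ℤ => jacobiTheta₂_term p.1 z σ * jacobiTheta₂_term p.2 w σ)
      (jacobiTheta₂ z σ * jacobiTheta₂ w σ) := by
    intro z w σ hσ
    exact hasSum_mul_prod (f := fun n => jacobiTheta₂_term n z σ)
      (g := fun n => jacobiTheta₂_term n w σ) (hasSum_jacobiTheta₂_term z hσ)
      (hasSum_jacobiTheta₂_term w hσ)
  let F : ℤ × ℤ → ℂ := fun p => jacobiTheta₂_term p.1 (a + b) τ * jacobiTheta₂_term p.2 (a - b) τ
  let g₀ : ℤ × ℤ → ℤ × ℤ := fun p => (p.1 + p.2, p.1 - p.2)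
  let g₁ : ℤ × ℤ → ℤ × ℤ := fun p => (p.1 + p.2 + 1, p.1 - p.2)
  have hg₀ : Function.Injective g₀ := by
    rintro ⟨a, b⟩ ⟨c, d⟩ h
    simp only [g₀, Prod.mk.injEq] at h ⊢
    omega
  have hg₁ : Function.Injective g₁ := by
    rintro ⟨a, b⟩ ⟨c, d⟩ h
    simp only [g₁, Prod.mk.injEq] at h ⊢
    omega
  have hcompl : IsCompl (Set.range g₀) (Set.range g₁) := by
    constructor
    · rw [Set.disjoint_left]
      rintro _ ⟨⟨a, b⟩, rfl⟩ ⟨⟨c, d⟩, h⟩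
      simp only [g₀, g₁, Prod.mk.injEq] at h
      omega
    · rw [codisjoint_iff_le_sup]
      rintro ⟨m, n⟩ -
      rcases Int.even_or_odd' (m + n) with ⟨j, h | h⟩
      · exact Or.inl ⟨(j, m - j), by simp only [g₀, Prod.mk.injEq]; omega⟩
      · exact Or.inr ⟨(j, m - j - 1), by simp only [g₁, Prod.mk.injEq]; omega⟩
  refine (prod hτ).unique (HasSum.add_isCompl hcompl ?_ ?_)
  · refine (hg₀.hasSum_range_iff (f := F)).2 ?_
    refine (prod hτ2).congr_fun ?_
    rintro ⟨j, k⟩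
    simp only [jacobiTheta₂_term, g₀, F, Function.comp, ← Complex.exp_add]
    congr 1
    push_cast
    ring
  · refine (hg₁.hasSum_range_iff (f := F)).2 ?_
    refine ((prod hτ2).mul_left _).congr_fun ?_
    rintro ⟨j, k⟩
    simp only [jacobiTheta₂_term, g₁, F, Function.comp, ← Complex.exp_add]
    congr 1
    push_cast
    ring

theorem theta4_neg (τ z : ℂ) : theta4 τ (-z) = theta4 τ z := by
  rw [theta4, theta4, ← jacobiTheta₂_neg_left, ← jacobiTheta₂_add_left]
  congr 1; ring

theorem theta1_neg (τ z : ℂ) : theta1 τ (-z) = -theta1 τ z := by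
  have hπ : (Real.pi : ℂ) ≠ 0 := by exact_mod_cast Real.pi_ne_zero
  have e1 : jacobiTheta₂ (-z / Real.pi + 1 / 2 + τ / 2) τ =
      jacobiTheta₂ (z / Real.pi + 1 / 2 + τ / 2 - τ) τ := by
    rw [← jacobiTheta₂_neg_left, ← jacobiTheta₂_add_left]
    congr 1; ring
  have e2 := jacobiTheta₂_add_left' (z / Real.pi + 1 / 2 + τ / 2 - τ) τ
  rw [sub_add_cancel] at e2
  rw [theta1, theta1, e1, e2]
  have : Complex.exp (Real.pi * Complex.I * τ / 4 + Complex.I * z) *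
      Complex.exp (-Real.pi * Complex.I * (τ + 2 * (z / Real.pi + 1 / 2 + τ / 2 - τ))) =
      -Complex.exp (Real.pi * Complex.I * τ / 4 + Complex.I * -z) := by
    rw [← Complex.exp_add, ← Complex.exp_sub_pi_mul_I]
    congr 1
    field_simp
    ring
  linear_combination -Complex.I * jacobiTheta₂ (z / Real.pi + 1 / 2 + τ / 2 - τ) τ * this

/-- The first of the two theta functions with modular parameter `2 τ` in terms of which the
products `θ₄ (x + y) θ₄ (x - y)` and `θ₁ (x + y) θ₁ (x - y)` are expressed. -/
def thetaDoubleEven (τ z : ℂ) : ℂ := jacobiTheta₂ (2 * (z / Real.pi)) (2 * τ)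

/-- The second of these theta functions. -/
def thetaDoubleOdd (τ z : ℂ) : ℂ :=
  Complex.exp (Real.pi * Complex.I * τ / 2 + 2 * Complex.I * z) *
    jacobiTheta₂ (2 * (z / Real.pi) + τ) (2 * τ)

/-- The half period `1/2` becomes a full period after doubling. Only the exponential factor of the
odd part notices it, and changes sign. -/
theorem theta4_add_mul_theta4_sub {τ : ℂ} (hτ : 0 < τ.im) (x y : ℂ) :
    theta4 τ (x + y) * theta4 τ (x - y) =
      thetaDoubleEven τ x * thetaDoubleEven τ y - thetaDoubleOdd τ x * thetaDoubleOdd τ y := by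
  have hπ : (Real.pi : ℂ) ≠ 0 := by exact_mod_cast Real.pi_ne_zero
  have h := jacobiTheta₂_add_mul_sub hτ (x / Real.pi + 1 / 2) (y / Real.pi)
  have a1 : x / Real.pi + 1 / 2 + y / Real.pi = (x + y) / Real.pi + 1 / 2 := by ring
  have a2 : x / Real.pi + 1 / 2 - y / Real.pi = (x - y) / Real.pi + 1 / 2 := by ring
  have a3 : 2 * (x / Real.pi + 1 / 2) = 2 * (x / Real.pi) + 1 := by ring
  have a4 : 2 * (x / Real.pi) + 1 + τ = 2 * (x / Real.pi) + τ + 1 := by ring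
  rw [a1, a2, a3, a4, jacobiTheta₂_add_left, jacobiTheta₂_add_left] at h
  have e : Complex.exp (2 * Real.pi * Complex.I * ((x + y) / Real.pi + 1 / 2) +
      Real.pi * Complex.I * τ) =
      -(Complex.exp (Real.pi * Complex.I * τ / 2 + 2 * Complex.I * x) *
        Complex.exp (Real.pi * Complex.I * τ / 2 + 2 * Complex.I * y)) := by
    rw [← neg_one_mul, ← Complex.exp_pi_mul_I, ← Complex.exp_add, ← Complex.exp_add]
    congr 1
    field_simp
    ring
  rw [e] at h
  rw [theta4, theta4, h, thetaDoubleEven, thetaDoubleEven, thetaDoubleOdd, thetaDoubleOdd]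
  ring

/-- The shift by `1/2 + τ/2` interchanges the even and odd functions of `x`. The product therefore
becomes a determinant. -/
theorem theta1_add_mul_theta1_sub {τ : ℂ} (hτ : 0 < τ.im) (x y : ℂ) :
    theta1 τ (x + y) * theta1 τ (x - y) =
      thetaDoubleEven τ x * thetaDoubleOdd τ y - thetaDoubleOdd τ x * thetaDoubleEven τ y := by
  have hπ : (Real.pi : ℂ) ≠ 0 := by exact_mod_cast Real.pi_ne_zero
  have h := jacobiTheta₂_add_mul_sub hτ (x / Real.pi + 1 / 2 + τ / 2) (y / Real.pi)
  have a1 : x / Real.pi + 1 / 2 + τ / 2 + y / Real.pi = (x + y) / Real.pi + 1 / 2 + τ / 2 := by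
    ring
  have a2 : x / Real.pi + 1 / 2 + τ / 2 - y / Real.pi = (x - y) / Real.pi + 1 / 2 + τ / 2 := by
    ring
  have a3 : 2 * (x / Real.pi + 1 / 2 + τ / 2) = 2 * (x / Real.pi) + τ + 1 := by ring
  have a4 : 2 * (x / Real.pi) + τ + 1 + τ = 2 * (x / Real.pi) + 2 * τ + 1 := by ring
  rw [a1, a2, a3, a4, jacobiTheta₂_add_left, jacobiTheta₂_add_left, jacobiTheta₂_add_left'] at h
  have e : Complex.exp (Real.pi * Complex.I * τ / 4 + Complex.I * (x + y)) *
      Complex.exp (Real.pi * Complex.I * τ / 4 + Complex.I * (x - y)) =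
      Complex.exp (Real.pi * Complex.I * τ / 2 + 2 * Complex.I * x) := by
    rw [← Complex.exp_add]; congr 1; ring
  have e2 : Complex.exp (Real.pi * Complex.I * τ / 2 + 2 * Complex.I * x) *
      (Complex.exp (2 * Real.pi * Complex.I * ((x + y) / Real.pi + 1 / 2 + τ / 2) +
      Real.pi * Complex.I * τ) *
      Complex.exp (-Real.pi * Complex.I * (2 * τ + 2 * (2 * (x / Real.pi))))) =
      -Complex.exp (Real.pi * Complex.I * τ / 2 + 2 * Complex.I * y) := by
    rw [← Complex.exp_add, ← Complex.exp_add, ← Complex.exp_add_pi_mul_I]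
    congr 1
    field_simp
    ring
  have h2 : theta1 τ (x + y) * theta1 τ (x - y) = Complex.I ^ 2 *
      (Complex.exp (Real.pi * Complex.I * τ / 4 + Complex.I * (x + y)) *
      Complex.exp (Real.pi * Complex.I * τ / 4 + Complex.I * (x - y))) *
      (jacobiTheta₂ ((x + y) / Real.pi + 1 / 2 + τ / 2) τ *
        jacobiTheta₂ ((x - y) / Real.pi + 1 / 2 + τ / 2) τ) := by
    rw [theta1, theta1]; ring
  rw [h2, e, h, Complex.I_sq, thetaDoubleEven, thetaDoubleEven, thetaDoubleOdd, thetaDoubleOdd]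
  linear_combination -jacobiTheta₂ (2 * (x / Real.pi)) (2 * τ) *
    jacobiTheta₂ (2 * (y / Real.pi) + τ) (2 * τ) * e2

/-- After the product formulas this is a polynomial identity in the even and odd functions at `x, y,
z`. No further property of theta functions is used. -/
theorem theta1_theta4_three_term {τ : ℂ} (hτ : 0 < τ.im) (x y z : ℂ) :
    theta1 τ (x + y) * theta1 τ (x - y) * (theta4 τ (z + y) * theta4 τ (z - y)) -
      theta1 τ (z + y) * theta1 τ (z - y) * (theta4 τ (x + y) * theta4 τ (x - y)) =
    theta4 τ (y + y) * theta4 τ (y - y) * (theta1 τ (x + z) * theta1 τ (x - z)) := by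
  simp only [theta1_add_mul_theta1_sub hτ, theta4_add_mul_theta4_sub hτ]
  ring

theorem theta4_theta1_three_term {τ : ℂ} (hτ : 0 < τ.im) (x y z : ℂ) :
    theta4 τ (x + y) * theta4 τ (x - y) * (theta4 τ (x + z) * theta4 τ (x - z)) -
      theta1 τ (x + y) * theta1 τ (x - y) * (theta1 τ (x + z) * theta1 τ (x - z)) =
    theta4 τ (x + x) * theta4 τ (x - x) * (theta4 τ (y + z) * theta4 τ (y - z)) := by
  simp only [theta1_add_mul_theta1_sub hτ, theta4_add_mul_theta4_sub hτ]
  ring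

/-! ### Addition theorems for `sn` -/

theorem SnFinite.neg {τ a : ℂ} (h : SnFinite τ a) : SnFinite τ (-a) := by
  rw [SnFinite, neg_div, theta4_neg]; exact h

theorem jacobiSn_neg (τ a : ℂ) : jacobiSn τ (-a) = -jacobiSn τ a := by
  rw [jacobiSn, jacobiSn, neg_div, theta4_neg, theta1_neg]; ring

/-- If `sn (a + b) = 0`, then `sn a` and `sn b` agree up to sign. -/
theorem jacobiSn_sq_eq_sq {τ a b : ℂ} (hτ : 0 < τ.im) (ha : SnFinite τ a) (hb : SnFinite τ b)
    (hab : SnFinite τ (a + b)) (h : jacobiSn τ (a + b) = 0) :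
    jacobiSn τ a ^ 2 = jacobiSn τ b ^ 2 := by
  have key := theta1_theta4_three_term hτ (a / theta3 τ 0 ^ 2) 0 (b / theta3 τ 0 ^ 2)
  rw [← add_div] at key
  simp only [add_zero, sub_zero] at key
  unfold SnFinite at ha hb hab
  unfold jacobiSn at h ⊢
  rcases mul_eq_zero.1 h with h0 | h0
  · rw [h0]; ring
  · rw [div_eq_zero_iff, or_iff_left hab] at h0
    rw [h0] at key
    rw [mul_pow, mul_pow, div_pow _ (theta4 τ (a / theta3 τ 0 ^ 2)),
      div_pow _ (theta4 τ (b / theta3 τ 0 ^ 2))]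
    congr 1
    rw [div_eq_div_iff (pow_ne_zero _ ha) (pow_ne_zero _ hb)]
    linear_combination key

/-- The classical formula for `sn (a + b) sn (a - b)`, the quotient of two three-term identities in
which `θ₄(0)²` cancels. It is kept without a denominator so that `1 - k² sn² a sn² b` may vanish. -/
theorem jacobiSn_mul_add_sub {τ a b : ℂ} (hτ : 0 < τ.im) (h2 : theta2 τ 0 ≠ 0)
    (h3 : theta3 τ 0 ≠ 0) (ha : SnFinite τ a) (hb : SnFinite τ b)
    (hp : SnFinite τ (a + b)) (hm : SnFinite τ (a - b)) :
    jacobiSn τ (a + b) * jacobiSn τ (a - b) *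
        (1 - ellipticModulus τ ^ 2 * jacobiSn τ a ^ 2 * jacobiSn τ b ^ 2) =
      jacobiSn τ a ^ 2 - jacobiSn τ b ^ 2 := by
  have k1 := theta1_theta4_three_term hτ (a / theta3 τ 0 ^ 2) 0 (b / theta3 τ 0 ^ 2)
  have k2 := theta4_theta1_three_term hτ 0 (a / theta3 τ 0 ^ 2) (b / theta3 τ 0 ^ 2)
  simp only [add_zero, sub_zero, zero_add, zero_sub, theta4_neg, theta1_neg] at k1 k2
  rw [← add_div, ← sub_div] at k1 k2
  unfold SnFinite at ha hb hp hm
  unfold jacobiSn ellipticModulus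
  generalize theta1 τ (a / theta3 τ 0 ^ 2) = a1 at *
  generalize theta4 τ (a / theta3 τ 0 ^ 2) = a4 at *
  generalize theta1 τ (b / theta3 τ 0 ^ 2) = b1 at *
  generalize theta4 τ (b / theta3 τ 0 ^ 2) = b4 at *
  generalize theta1 τ ((a + b) / theta3 τ 0 ^ 2) = p1 at *
  generalize theta4 τ ((a + b) / theta3 τ 0 ^ 2) = p4 at *
  generalize theta1 τ ((a - b) / theta3 τ 0 ^ 2) = m1 at *
  generalize theta4 τ ((a - b) / theta3 τ 0 ^ 2) = m4 at *
  generalize theta4 τ 0 = t at *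
  field_simp
  linear_combination p1 * m1 * k2 - p4 * m4 * k1

/-- This and the next three are three-term identities at half sums, chosen so that all arguments are
among `a, b, c` and their differences, apart from `0` and `a + c - b`. The latter two occur only in
factors common to a pair of right-hand sides. -/
theorem theta_addition_odd {τ : ℂ} (hτ : 0 < τ.im) (a b c : ℂ) :
    theta1 τ a * theta1 τ c * (theta4 τ (a - b) * theta4 τ (b - c)) +
      theta1 τ (a - b) * theta1 τ (b - c) * (theta4 τ a * theta4 τ c) =
    theta4 τ (a - c) * theta4 τ 0 * (theta1 τ (a + c - b) * theta1 τ b) := by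
  have h := theta1_theta4_three_term hτ ((a + c) / 2) ((a - c) / 2) ((a + c) / 2 - b)
  rw [show (a + c) / 2 + (a - c) / 2 = a by ring, show (a + c) / 2 - (a - c) / 2 = c by ring,
    show (a + c) / 2 - b + (a - c) / 2 = a - b by ring,
    show (a + c) / 2 - b - (a - c) / 2 = -(b - c) by ring,
    show (a + c) / 2 + ((a + c) / 2 - b) = a + c - b by ring,
    show (a + c) / 2 - ((a + c) / 2 - b) = b by ring,
    show (a - c) / 2 + (a - c) / 2 = a - c by ring,
    show (a - c) / 2 - (a - c) / 2 = 0 by ring, theta4_neg, theta1_neg] at h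
  linear_combination h

theorem theta_addition_odd' {τ : ℂ} (hτ : 0 < τ.im) (a b c : ℂ) :
    theta1 τ a * theta1 τ (a - b) * (theta4 τ c * theta4 τ (b - c)) +
      theta1 τ c * theta1 τ (b - c) * (theta4 τ a * theta4 τ (a - b)) =
    theta4 τ b * theta4 τ 0 * (theta1 τ (a + c - b) * theta1 τ (a - c)) := by
  have h := theta1_theta4_three_term hτ (a - b / 2) (b / 2) (c - b / 2)
  rw [show a - b / 2 + b / 2 = a by ring, show a - b / 2 - b / 2 = a - b by ring,
    show c - b / 2 + b / 2 = c by ring, show c - b / 2 - b / 2 = -(b - c) by ring,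
    show a - b / 2 + (c - b / 2) = a + c - b by ring,
    show a - b / 2 - (c - b / 2) = a - c by ring, show b / 2 + b / 2 = b by ring,
    show b / 2 - b / 2 = 0 by ring, theta4_neg, theta1_neg] at h
  linear_combination h

theorem theta_addition_even {τ : ℂ} (hτ : 0 < τ.im) (a b c : ℂ) :
    theta1 τ c * theta1 τ (a - b) * (theta4 τ a * theta4 τ (b - c)) +
      theta1 τ a * theta1 τ (b - c) * (theta4 τ c * theta4 τ (a - b)) =
    theta4 τ (a + c - b) * theta4 τ 0 * (theta1 τ b * theta1 τ (a - c)) := by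
  have h := theta1_theta4_three_term hτ ((c - (a - b)) / 2) ((a + c - b) / 2) ((a + (b - c)) / 2)
  rw [show (c - (a - b)) / 2 + (a + c - b) / 2 = c by ring,
    show (c - (a - b)) / 2 - (a + c - b) / 2 = -(a - b) by ring,
    show (a + (b - c)) / 2 + (a + c - b) / 2 = a by ring,
    show (a + (b - c)) / 2 - (a + c - b) / 2 = b - c by ring,
    show (c - (a - b)) / 2 + (a + (b - c)) / 2 = b by ring,
    show (c - (a - b)) / 2 - (a + (b - c)) / 2 = -(a - c) by ring,
    show (a + c - b) / 2 + (a + c - b) / 2 = a + c - b by ring,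
    show (a + c - b) / 2 - (a + c - b) / 2 = 0 by ring, theta4_neg, theta1_neg, theta1_neg] at h
  linear_combination -h

theorem theta_addition_even' {τ : ℂ} (hτ : 0 < τ.im) (a b c : ℂ) :
    theta4 τ a * theta4 τ c * (theta4 τ (a - b) * theta4 τ (b - c)) +
      theta1 τ a * theta1 τ c * (theta1 τ (a - b) * theta1 τ (b - c)) =
    theta4 τ (a + c - b) * theta4 τ 0 * (theta4 τ b * theta4 τ (a - c)) := by
  have h := theta4_theta1_three_term hτ ((a + c - b) / 2) ((a + b - c) / 2) ((c - (a - b)) / 2)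
  rw [show (a + c - b) / 2 + (a + b - c) / 2 = a by ring,
    show (a + c - b) / 2 - (a + b - c) / 2 = -(b - c) by ring,
    show (a + c - b) / 2 + (c - (a - b)) / 2 = c by ring,
    show (a + c - b) / 2 - (c - (a - b)) / 2 = a - b by ring,
    show (a + c - b) / 2 + (a + c - b) / 2 = a + c - b by ring,
    show (a + c - b) / 2 - (a + c - b) / 2 = 0 by ring,
    show (a + b - c) / 2 + (c - (a - b)) / 2 = b by ring,
    show (a + b - c) / 2 - (c - (a - b)) / 2 = a - c by ring, theta4_neg, theta1_neg] at h
  linear_combination h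

/-- The addition theorem of `sn` for three arguments and their differences, first form. -/
theorem jacobiSn_three_arguments {τ a b c : ℂ} (hτ : 0 < τ.im) (ha : SnFinite τ a)
    (hb : SnFinite τ b) (hc : SnFinite τ c) (hab : SnFinite τ (a - b)) (hbc : SnFinite τ (b - c))
    (hac : SnFinite τ (a - c)) :
    jacobiSn τ a * jacobiSn τ c * jacobiSn τ (a - c) +
        jacobiSn τ (a - b) * jacobiSn τ (b - c) * jacobiSn τ (a - c) =
      jacobiSn τ a * jacobiSn τ b * jacobiSn τ (a - b) +
        jacobiSn τ b * jacobiSn τ c * jacobiSn τ (b - c) := by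
  have k1 := theta_addition_odd hτ (a / theta3 τ 0 ^ 2) (b / theta3 τ 0 ^ 2) (c / theta3 τ 0 ^ 2)
  have k2 := theta_addition_odd' hτ (a / theta3 τ 0 ^ 2) (b / theta3 τ 0 ^ 2) (c / theta3 τ 0 ^ 2)
  rw [← add_div] at k1 k2
  simp only [← sub_div] at k1 k2
  unfold SnFinite at ha hb hc hab hbc hac
  unfold jacobiSn
  generalize theta3 τ 0 / theta2 τ 0 = K at *
  generalize theta1 τ (a / theta3 τ 0 ^ 2) = a1 at *
  generalize theta4 τ (a / theta3 τ 0 ^ 2) = a4 at *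
  generalize theta1 τ (b / theta3 τ 0 ^ 2) = b1 at *
  generalize theta4 τ (b / theta3 τ 0 ^ 2) = b4 at *
  generalize theta1 τ (c / theta3 τ 0 ^ 2) = c1 at *
  generalize theta4 τ (c / theta3 τ 0 ^ 2) = c4 at *
  generalize theta1 τ ((a - b) / theta3 τ 0 ^ 2) = ab1 at *
  generalize theta4 τ ((a - b) / theta3 τ 0 ^ 2) = ab4 at *
  generalize theta1 τ ((b - c) / theta3 τ 0 ^ 2) = bc1 at *
  generalize theta4 τ ((b - c) / theta3 τ 0 ^ 2) = bc4 at *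
  generalize theta1 τ ((a - c) / theta3 τ 0 ^ 2) = ac1 at *
  generalize theta4 τ ((a - c) / theta3 τ 0 ^ 2) = ac4 at *
  field_simp
  -- The multipliers are chosen so that the right-hand sides, which contain `θ₁(a + c - b) θ₄(0)`,
  -- cancel.
  linear_combination K ^ 3 * (ac1 * b4) * k1 - K ^ 3 * (b1 * ac4) * k2

/-- The addition theorem of `sn` for three arguments and their differences, second form. -/
theorem jacobiSn_three_arguments' {τ a b c : ℂ} (hτ : 0 < τ.im) (h2 : theta2 τ 0 ≠ 0)
    (h3 : theta3 τ 0 ≠ 0) (ha : SnFinite τ a)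
    (hb : SnFinite τ b) (hc : SnFinite τ c) (hab : SnFinite τ (a - b)) (hbc : SnFinite τ (b - c))
    (hac : SnFinite τ (a - c)) :
    jacobiSn τ a * jacobiSn τ (b - c) + jacobiSn τ c * jacobiSn τ (a - b) =
      jacobiSn τ b * jacobiSn τ (a - c) + ellipticModulus τ ^ 2 * jacobiSn τ a * jacobiSn τ b *
        jacobiSn τ c * jacobiSn τ (a - b) * jacobiSn τ (b - c) * jacobiSn τ (a - c) := by
  have k1 := theta_addition_even hτ (a / theta3 τ 0 ^ 2) (b / theta3 τ 0 ^ 2) (c / theta3 τ 0 ^ 2)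
  have k2 := theta_addition_even' hτ (a / theta3 τ 0 ^ 2) (b / theta3 τ 0 ^ 2) (c / theta3 τ 0 ^ 2)
  rw [← add_div] at k1 k2
  simp only [← sub_div] at k1 k2
  unfold SnFinite at ha hb hc hab hbc hac
  unfold jacobiSn ellipticModulus
  generalize theta1 τ (a / theta3 τ 0 ^ 2) = a1 at *
  generalize theta4 τ (a / theta3 τ 0 ^ 2) = a4 at *
  generalize theta1 τ (b / theta3 τ 0 ^ 2) = b1 at *
  generalize theta4 τ (b / theta3 τ 0 ^ 2) = b4 at *
  generalize theta1 τ (c / theta3 τ 0 ^ 2) = c1 at *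
  generalize theta4 τ (c / theta3 τ 0 ^ 2) = c4 at *
  generalize theta1 τ ((a - b) / theta3 τ 0 ^ 2) = ab1 at *
  generalize theta4 τ ((a - b) / theta3 τ 0 ^ 2) = ab4 at *
  generalize theta1 τ ((b - c) / theta3 τ 0 ^ 2) = bc1 at *
  generalize theta4 τ ((b - c) / theta3 τ 0 ^ 2) = bc4 at *
  generalize theta1 τ ((a - c) / theta3 τ 0 ^ 2) = ac1 at *
  generalize theta4 τ ((a - c) / theta3 τ 0 ^ 2) = ac4 at *
  generalize theta2 τ 0 = t2 at *
  generalize theta3 τ 0 = t3 at *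
  field_simp
  -- Here the common right-hand factor `θ₄(a + c - b) θ₄(0)` is eliminated.
  linear_combination (b4 * ac4) * k1 - (b1 * ac1) * k2

theorem degreeOf_le_one_of_pderiv_pderiv {σ : Type*} {i : σ} {f : MvPolynomial σ ℂ}
    (h : pderiv i (pderiv i f) = 0) : degreeOf i f ≤ 1 := by
  classical
  rw [degreeOf_le_iff]
  intro m hm
  by_contra hmi
  have hle : Finsupp.single i 1 + Finsupp.single i 1 ≤ m := by
    rw [← Finsupp.single_add, Finsupp.single_le_iff]; omega
  have hc := coeff_pderiv (i := i) (pderiv i f) (m - (Finsupp.single i 1 + Finsupp.single i 1))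
  rw [h, coeff_zero, coeff_pderiv, add_assoc, tsub_add_cancel_of_le hle] at hc
  rcases mul_eq_zero.1 hc.symm with h0 | h0
  · rcases mul_eq_zero.1 h0 with h0 | h0
    · exact mem_support_iff.1 hm h0
    · exact absurd h0 (Nat.cast_add_one_ne_zero _)
  · exact absurd h0 (Nat.cast_add_one_ne_zero _)

/-! ### The common shape of the bulk polynomials -/

/-- Coefficients of
`a (x u + v y) + b (x v + u y) + c (x y + u v) + l (x + u + v + y) + k + m x u v y`. -/
structure QuadCoeffs where
  (a b c l k m : ℂ)

namespace QuadCoeffs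

/-- The polynomial with the given coefficients. -/
def poly (q : QuadCoeffs) : MvPolynomial (Fin 4) ℂ :=
  C q.a * (X 0 * X 1 + X 2 * X 3) + C q.b * (X 0 * X 2 + X 1 * X 3)
    + C q.c * (X 0 * X 3 + X 1 * X 2) + C q.l * (X 0 + X 1 + X 2 + X 3) + C q.k
    + C q.m * (X 0 * X 1 * X 2 * X 3)

/-- The value of this polynomial. -/
def val (q : QuadCoeffs) (x u v y : ℂ) : ℂ :=
  q.a * (x * u + v * y) + q.b * (x * v + u * y) + q.c * (x * y + u * v) + q.l * (x + u + v + y)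
    + q.k + q.m * (x * u * v * y)

/-- The discriminant `Q Q_{uv} - Q_u Q_v`, a polynomial in `x` and `y`. -/
def disc (q : QuadCoeffs) (x y : ℂ) : ℂ :=
  (q.c * (x * y) + q.l * (x + y) + q.k) * (q.c + q.m * (x * y))
    - (q.a * x + q.b * y + q.l) * (q.a * y + q.b * x + q.l)

/-- The coefficients of `Q(x, u, y, v)`. -/
def swapVY (q : QuadCoeffs) : QuadCoeffs := ⟨q.a, q.c, q.b, q.l, q.k, q.m⟩

/-- The coefficients of `Q(x, y, v, u)`. -/
def swapUY (q : QuadCoeffs) : QuadCoeffs := ⟨q.c, q.b, q.a, q.l, q.k, q.m⟩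

theorem eval_poly (q : QuadCoeffs) (x u v y : ℂ) : eval ![x, u, v, y] q.poly = q.val x u v y := by
  simp [poly, val]

theorem pderiv_zero_poly (q : QuadCoeffs) : pderiv 0 q.poly =
    C q.a * X 1 + C q.b * X 2 + C q.c * X 3 + C q.l + C q.m * (X 1 * X 2 * X 3) := by
  simp only [poly, map_add, pderiv_mul, pderiv_C, pderiv_X, Pi.single_apply, Fin.reduceEq,
    ↓reduceIte]
  ring

theorem pderiv_one_poly (q : QuadCoeffs) : pderiv 1 q.poly =
    C q.a * X 0 + C q.b * X 3 + C q.c * X 2 + C q.l + C q.m * (X 0 * X 2 * X 3) := by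
  simp only [poly, map_add, pderiv_mul, pderiv_C, pderiv_X, Pi.single_apply, Fin.reduceEq,
    ↓reduceIte]
  ring

theorem pderiv_two_poly (q : QuadCoeffs) : pderiv 2 q.poly =
    C q.a * X 3 + C q.b * X 0 + C q.c * X 1 + C q.l + C q.m * (X 0 * X 1 * X 3) := by
  simp only [poly, map_add, pderiv_mul, pderiv_C, pderiv_X, Pi.single_apply, Fin.reduceEq,
    ↓reduceIte]
  ring

theorem pderiv_three_poly (q : QuadCoeffs) : pderiv 3 q.poly =
    C q.a * X 2 + C q.b * X 1 + C q.c * X 0 + C q.l + C q.m * (X 0 * X 1 * X 2) := by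
  simp only [poly, map_add, pderiv_mul, pderiv_C, pderiv_X, Pi.single_apply, Fin.reduceEq,
    ↓reduceIte]
  ring

theorem pderiv_pderiv_poly (q : QuadCoeffs) (i : Fin 4) : pderiv i (pderiv i q.poly) = 0 := by
  fin_cases i
  · simp [pderiv_zero_poly, pderiv_X]
  · simp [pderiv_one_poly, pderiv_X]
  · simp [pderiv_two_poly, pderiv_X]
  · simp [pderiv_three_poly, pderiv_X]

theorem degreeOf_poly_le_one (q : QuadCoeffs) (i : Fin 4) : degreeOf i q.poly ≤ 1 :=
  degreeOf_le_one_of_pderiv_pderiv (q.pderiv_pderiv_poly i)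

/-- The common shape is invariant under the double exchanges of its arguments, so the discriminants
for complementary pairs of variables are the same function. Six discriminants reduce to three,
namely `disc` for `q`, `q.swapVY` and `q.swapUY`. -/
theorem eval_discr_one_two (q : QuadCoeffs) (x u v y : ℂ) :
    eval ![x, u, v, y] (q.poly * pderiv 1 (pderiv 2 q.poly) - pderiv 1 q.poly * pderiv 2 q.poly) =
      q.disc x y := by
  rw [pderiv_one_poly, pderiv_two_poly]
  simp [poly, disc, pderiv_X]; ring

theorem eval_discr_one_three (q : QuadCoeffs) (x u v y : ℂ) :
    eval ![x, u, v, y] (q.poly * pderiv 1 (pderiv 3 q.poly) - pderiv 1 q.poly * pderiv 3 q.poly) =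
      q.swapVY.disc x v := by
  rw [pderiv_one_poly, pderiv_three_poly]
  simp [poly, disc, swapVY, pderiv_X]; ring

theorem eval_discr_two_three (q : QuadCoeffs) (x u v y : ℂ) :
    eval ![x, u, v, y] (q.poly * pderiv 2 (pderiv 3 q.poly) - pderiv 2 q.poly * pderiv 3 q.poly) =
      q.swapUY.disc x u := by
  rw [pderiv_two_poly, pderiv_three_poly]
  simp [poly, disc, swapUY, pderiv_X]; ring

theorem eval_discr_zero_one (q : QuadCoeffs) (x u v y : ℂ) :
    eval ![x, u, v, y] (q.poly * pderiv 0 (pderiv 1 q.poly) - pderiv 0 q.poly * pderiv 1 q.poly) =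
      q.swapUY.disc v y := by
  rw [pderiv_one_poly, pderiv_zero_poly]
  simp [poly, disc, swapUY, pderiv_X]; ring

theorem eval_discr_zero_two (q : QuadCoeffs) (x u v y : ℂ) :
    eval ![x, u, v, y] (q.poly * pderiv 0 (pderiv 2 q.poly) - pderiv 0 q.poly * pderiv 2 q.poly) =
      q.swapVY.disc u y := by
  rw [pderiv_two_poly, pderiv_zero_poly]
  simp [poly, disc, swapVY, pderiv_X]; ring

theorem eval_discr_zero_three (q : QuadCoeffs) (x u v y : ℂ) :
    eval ![x, u, v, y] (q.poly * pderiv 0 (pderiv 3 q.poly) - pderiv 0 q.poly * pderiv 3 q.poly) =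
      q.disc u v := by
  rw [pderiv_three_poly, pderiv_zero_poly]
  simp [poly, disc, pderiv_X]; ring

theorem exists_eval_ne_zero {n : ℕ} {f : MvPolynomial (Fin n) ℂ} (hf : f ≠ 0) :
    ∃ p, eval p f ≠ 0 := by
  by_contra! h
  exact hf (funext fun p => by rw [h p, map_zero])

theorem pderiv_poly_ne_zero {q : QuadCoeffs} (h : Irreducible q.poly) (i : Fin 4) :
    pderiv i q.poly ≠ 0 := by
  -- All four derivatives have this form up to the order of the variables. If it vanishes
  -- identically, only the constant `k` is left of the polynomial, which is then not irreducible.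
  have main : ∀ g : MvPolynomial (Fin 4) ℂ, (∀ x u v y : ℂ, eval ![x, u, v, y] g =
      q.a * x + q.b * u + q.c * v + q.l + q.m * (x * u * v)) → g ≠ 0 := by
    rintro g hg rfl
    simp only [map_zero] at hg
    have e0 := hg 0 0 0 0
    have ea := hg 1 0 0 0
    have eb := hg 0 1 0 0
    have ec := hg 0 0 1 0
    have em := hg 1 1 1 0
    simp only [mul_zero, mul_one, zero_add, add_zero] at e0 ea eb ec em
    have l0 : q.l = 0 := e0.symm
    have a0 : q.a = 0 := by linear_combination e0 - ea
    have b0 : q.b = 0 := by linear_combination e0 - eb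
    have c0 : q.c = 0 := by linear_combination e0 - ec
    have m0 : q.m = 0 := by linear_combination -em - l0 - a0 - b0 - c0
    have hp : q.poly = C q.k := by
      rw [poly, a0, b0, c0, l0, m0, C_0]; ring
    rw [hp] at h
    by_cases hk : q.k = 0
    · rw [hk, C_0] at h; exact h.ne_zero rfl
    · exact h.not_isUnit ((isUnit_iff_ne_zero.2 hk).map C)
  intro h0
  have hz : ∀ x u v y : ℂ, eval ![x, u, v, y] (pderiv i q.poly) = 0 := by simp [h0]
  fin_cases i
  · refine main 0 (fun x u v y => ?_) rfl
    rw [map_zero, ← hz y x u v]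
    simp [pderiv_zero_poly]
  · refine main 0 (fun x u v y => ?_) rfl
    rw [map_zero, ← hz x y v u]
    simp [pderiv_one_poly]; exact Or.inl (by ring)
  · refine main 0 (fun x u v y => ?_) rfl
    rw [map_zero, ← hz u v y x]
    simp [pderiv_two_poly]; exact Or.inl (by ring)
  · refine main 0 (fun x u v y => ?_) rfl
    rw [map_zero, ← hz v u x y]
    simp [pderiv_three_poly]; exact Or.inl (by ring)

theorem discr_poly_ne_zero {q : QuadCoeffs} (h : Irreducible q.poly) {i j : Fin 4} (hij : i ≠ j) :
    q.poly * pderiv i (pderiv j q.poly) - pderiv i q.poly * pderiv j q.poly ≠ 0 :=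
  discr_ne_zero_of_irreducible hij h (q.pderiv_pderiv_poly i) (q.pderiv_pderiv_poly j)
    (pderiv_poly_ne_zero h i) (pderiv_poly_ne_zero h j)

theorem eta_fin_four (p : Fin 4 → ℂ) : p = ![p 0, p 1, p 2, p 3] := by
  ext i; fin_cases i <;> rfl

theorem exists_disc_ne_zero {q : QuadCoeffs} (h : Irreducible q.poly) :
    ∃ x y, q.disc x y ≠ 0 := by
  obtain ⟨p, hp⟩ := exists_eval_ne_zero (discr_poly_ne_zero h (show (1 : Fin 4) ≠ 2 by decide))
  rw [eta_fin_four p, eval_discr_one_two] at hp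
  exact ⟨_, _, hp⟩

theorem exists_disc_swapVY_ne_zero {q : QuadCoeffs} (h : Irreducible q.poly) :
    ∃ x y, q.swapVY.disc x y ≠ 0 := by
  obtain ⟨p, hp⟩ := exists_eval_ne_zero (discr_poly_ne_zero h (show (1 : Fin 4) ≠ 3 by decide))
  rw [eta_fin_four p, eval_discr_one_three] at hp
  exact ⟨_, _, hp⟩

theorem exists_disc_swapUY_ne_zero {q : QuadCoeffs} (h : Irreducible q.poly) :
    ∃ x y, q.swapUY.disc x y ≠ 0 := by
  obtain ⟨p, hp⟩ := exists_eval_ne_zero (discr_poly_ne_zero h (show (2 : Fin 4) ≠ 3 by decide))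
  rw [eta_fin_four p, eval_discr_two_three] at hp
  exact ⟨_, _, hp⟩

/-- The coefficient of `x²` in `q.disc x 0` is `-a b`; the values at `0, 1, -1` recover it. -/
theorem exists_disc_ne_zero_of_mul_ne_zero {q : QuadCoeffs} (h : q.a * q.b ≠ 0) :
    ∃ x, q.disc x 0 ≠ 0 := by
  by_contra! h0
  have e0 := h0 0
  have e1 := h0 1
  have e2 := h0 (-1)
  simp only [disc, mul_zero, add_zero, mul_one] at e0 e1 e2
  apply h
  linear_combination e0 - (1 / 2) * e1 - (1 / 2) * e2

theorem irreducible_poly {q : QuadCoeffs} (ha : q.a ≠ 0) (hb : q.b ≠ 0) (hc : q.c ≠ 0) :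
    Irreducible q.poly := by
  obtain ⟨x₁, h₁⟩ := exists_disc_ne_zero_of_mul_ne_zero (mul_ne_zero ha hb)
  obtain ⟨x₂, h₂⟩ := exists_disc_ne_zero_of_mul_ne_zero (q := q.swapVY) (mul_ne_zero ha hc)
  obtain ⟨x₃, h₃⟩ := exists_disc_ne_zero_of_mul_ne_zero (q := q.swapUY) (mul_ne_zero hc hb)
  obtain ⟨D, hD⟩ : ∃ D : Fin 4 → Fin 4 → MvPolynomial (Fin 4) ℂ, ∀ i j, D i j =
      q.poly * pderiv i (pderiv j q.poly) - pderiv i q.poly * pderiv j q.poly := ⟨_, fun _ _ => rfl⟩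
  have symm : ∀ i j : Fin 4, D j i = D i j := by
    intro i j
    rw [hD, hD, pderiv_comm i j, mul_comm (pderiv i q.poly)]
  have h01 : D 0 1 ≠ 0 := fun h0 =>
    h₃ (by rw [← eval_discr_zero_one q 0 0 x₃ 0, ← hD, h0, map_zero])
  have h02 : D 0 2 ≠ 0 := fun h0 =>
    h₂ (by rw [← eval_discr_zero_two q 0 x₂ 0 0, ← hD, h0, map_zero])
  have h03 : D 0 3 ≠ 0 := fun h0 =>
    h₁ (by rw [← eval_discr_zero_three q 0 x₁ 0 0, ← hD, h0, map_zero])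
  have h12 : D 1 2 ≠ 0 := fun h0 =>
    h₁ (by rw [← eval_discr_one_two q x₁ 0 0 0, ← hD, h0, map_zero])
  have h13 : D 1 3 ≠ 0 := fun h0 =>
    h₂ (by rw [← eval_discr_one_three q x₂ 0 0 0, ← hD, h0, map_zero])
  have h23 : D 2 3 ≠ 0 := fun h0 =>
    h₃ (by rw [← eval_discr_two_three q x₃ 0 0 0, ← hD, h0, map_zero])
  refine irreducible_of_discr_ne_zero q.degreeOf_poly_le_one fun i j hij => ?_
  rw [← hD]
  match i, j, hij with
  | 0, 1, _ => exact h01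
  | 0, 2, _ => exact h02
  | 0, 3, _ => exact h03
  | 1, 2, _ => exact h12
  | 1, 3, _ => exact h13
  | 2, 3, _ => exact h23
  | 1, 0, _ => rw [symm]; exact h01
  | 2, 0, _ => rw [symm]; exact h02
  | 3, 0, _ => rw [symm]; exact h03
  | 2, 1, _ => rw [symm]; exact h12
  | 3, 1, _ => rw [symm]; exact h13
  | 3, 2, _ => rw [symm]; exact h23
  | 0, 0, h | 1, 1, h | 2, 2, h | 3, 3, h => exact absurd rfl h

end QuadCoeffs

/-! ### Coefficients and symmetries of the bulk polynomials -/

namespace BulkType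

/-- The coefficients of the bulk polynomial. -/
def coeffs (E : BulkType) (α β : ℂ) : QuadCoeffs :=
  match E with
  | .Q1 δ => ⟨α, -β, β - α, 0, δ ^ 2 * α * β * (α - β), 0⟩
  | .Q2 => ⟨α, -β, β - α, α * β * (α - β),
      -(α * β * (α - β) * (α ^ 2 - α * β + β ^ 2)), 0⟩
  | .Q3 δ => ⟨Complex.sinh α, -Complex.sinh β, -Complex.sinh (α - β), 0,
      δ * Complex.sinh (α - β) * Complex.sinh α * Complex.sinh β, 0⟩
  | .Q4 τ => ⟨jacobiSn τ α, -jacobiSn τ β, -jacobiSn τ (α - β), 0,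
      jacobiSn τ (α - β) * jacobiSn τ α * jacobiSn τ β,
      jacobiSn τ (α - β) * jacobiSn τ α * jacobiSn τ β * ellipticModulus τ ^ 2⟩
  | .H1 => ⟨1, -1, 0, 0, β - α, 0⟩
  | .H2 => ⟨1, -1, 0, β - α, β ^ 2 - α ^ 2, 0⟩
  | .H3 δ => ⟨Complex.exp α, -Complex.exp β, 0, 0,
      δ * (Complex.exp (2 * α) - Complex.exp (2 * β)), 0⟩
  | .A1 δ => ⟨α, -β, α - β, 0, -(δ ^ 2 * α * β * (α - β)), 0⟩
  | .A2 => ⟨-Complex.sinh β, Complex.sinh α, 0, 0, -Complex.sinh (α - β),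
      -Complex.sinh (α - β)⟩

theorem poly_eq (E : BulkType) (α β : ℂ) : E.poly α β = (E.coeffs α β).poly := by
  cases E <;>
    simp only [BulkType.poly, coeffs, QuadCoeffs.poly, map_neg, map_sub, map_mul, map_pow, map_zero,
      map_one, map_add] <;> ring

theorem Q_eq (E : BulkType) (x u v y α β : ℂ) : E.Q x u v y α β = (E.coeffs α β).val x u v y := by
  rw [BulkType.Q, poly_eq, QuadCoeffs.eval_poly]

/-- Exchange of `x, u` and of `v, y`. -/
theorem Q_swap_horizontal (E : BulkType) (x u v y α β : ℂ) :
    E.Q x u v y α β = E.Q u x y v α β := by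
  simp only [Q_eq, QuadCoeffs.val]; ring

/-- Exchange of `x, v` and of `u, y`. -/
theorem Q_swap_vertical (E : BulkType) (x u v y α β : ℂ) :
    E.Q x u v y α β = E.Q v y x u α β := by
  simp only [Q_eq, QuadCoeffs.val]; ring

theorem Q_reverse (E : BulkType) (x u v y α β : ℂ) :
    E.Q x u v y α β = E.Q y v u x α β := by
  simp only [Q_eq, QuadCoeffs.val]; ring

theorem sinh_sub_comm (α β : ℂ) : Complex.sinh (β - α) = -Complex.sinh (α - β) := by
  rw [← neg_sub, Complex.sinh_neg]

theorem jacobiSn_sub_comm (τ α β : ℂ) : jacobiSn τ (β - α) = -jacobiSn τ (α - β) := by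
  rw [← neg_sub, jacobiSn_neg]

theorem Q_swap_parameters (E : BulkType) (x u v y α β : ℂ) :
    E.Q x v u y β α = -E.Q x u v y α β := by
  simp only [Q_eq, QuadCoeffs.val]
  cases E <;> simp only [coeffs, sinh_sub_comm α β, jacobiSn_sub_comm _ α β] <;> ring

theorem tetrahedron_tetrahedron (E : BulkType) : E.tetrahedron.tetrahedron = E.tetrahedron := by
  cases E <;> rfl

/-- For equations of Q-type, the change of the sign of both parameters changes the sign of `Q`. -/
theorem Q_neg_parameters {E : BulkType} (hE : E.tetrahedron = E) (x u v y α β : ℂ) :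
    E.Q x u v y (-α) (-β) = -E.Q x u v y α β := by
  simp only [Q_eq, QuadCoeffs.val]
  cases E <;> simp only [tetrahedron, reduceCtorEq] at hE <;>
    simp only [coeffs, show -α - -β = -(α - β) by ring, Complex.sinh_neg, jacobiSn_neg] <;> ring

/-- Equations of Q-type have the symmetry of a tetrahedron. -/
theorem Q_swap_last {E : BulkType} (hE : E.tetrahedron = E) (x u v y α β : ℂ) :
    E.Q x u y v α (α - β) = E.Q x u v y α β := by
  simp only [Q_eq, QuadCoeffs.val]
  cases E <;> simp only [tetrahedron, reduceCtorEq] at hE <;>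
    simp only [coeffs, show α - (α - β) = β by ring] <;> ring

/-! ### Conditions on the parameters -/

/-- The coefficients of `Q` are finite, and those of its parameter-dependent factors that may
vanish do not. -/
def Good (E : BulkType) (α β : ℂ) : Prop :=
  match E with
  | .Q1 _ | .Q2 | .A1 _ => α ≠ 0 ∧ β ≠ 0 ∧ α - β ≠ 0
  | .Q3 _ | .A2 => Complex.sinh α ≠ 0 ∧ Complex.sinh β ≠ 0 ∧ Complex.sinh (α - β) ≠ 0
  | .Q4 τ => (SnFinite τ α ∧ SnFinite τ β ∧ SnFinite τ (α - β)) ∧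
      jacobiSn τ α ≠ 0 ∧ jacobiSn τ β ≠ 0 ∧ jacobiSn τ (α - β) ≠ 0
  | .H1 | .H2 => α - β ≠ 0
  | .H3 _ => Complex.sinh (α - β) ≠ 0

theorem Regular.irreducible {E : BulkType} {α β : ℂ} (h : E.Regular α β) :
    Irreducible (E.coeffs α β).poly := poly_eq E α β ▸ h.2

theorem Good.comm {E : BulkType} {α β : ℂ} (h : E.Good α β) : E.Good β α := by
  cases E <;> simp only [Good, sinh_sub_comm α β, jacobiSn_sub_comm _ α β, neg_ne_zero] at h ⊢
  case Q4 τ => exact ⟨⟨h.1.2.1, h.1.1, neg_sub α β ▸ h.1.2.2.neg⟩, h.2.2.1, h.2.1, h.2.2.2⟩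
  case H3 => exact h
  case Q3 => exact ⟨h.2.1, h.1, h.2.2⟩
  case A2 => exact ⟨h.2.1, h.1, h.2.2⟩
  case H1 => exact sub_ne_zero.2 (sub_ne_zero.1 h).symm
  case H2 => exact sub_ne_zero.2 (sub_ne_zero.1 h).symm
  all_goals exact ⟨h.2.1, h.1, sub_ne_zero.2 (sub_ne_zero.1 h.2.2).symm⟩

theorem false_of_disc_eq_zero {q : QuadCoeffs} (h : Irreducible q.poly)
    (h0 : (∀ x y, q.disc x y = 0) ∨ (∀ x y, q.swapVY.disc x y = 0) ∨
      (∀ x y, q.swapUY.disc x y = 0)) : False := by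
  rcases h0 with h0 | h0 | h0
  · obtain ⟨x, y, hxy⟩ := QuadCoeffs.exists_disc_ne_zero h; exact hxy (h0 x y)
  · obtain ⟨x, y, hxy⟩ := QuadCoeffs.exists_disc_swapVY_ne_zero h; exact hxy (h0 x y)
  · obtain ⟨x, y, hxy⟩ := QuadCoeffs.exists_disc_swapUY_ne_zero h; exact hxy (h0 x y)

/-- From `sinh (α + β) sinh (α - β) = sinh² α - sinh² β`. -/
theorem sinh_sq_of_sub_eq_zero {α β : ℂ} (h : Complex.sinh (α - β) = 0) :
    Complex.sinh α ^ 2 = Complex.sinh β ^ 2 := by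
  rw [Complex.sinh_sub] at h
  have h1 := Complex.cosh_sq α
  have h2 := Complex.cosh_sq β
  linear_combination (Complex.sinh α * Complex.cosh β + Complex.cosh α * Complex.sinh β) * h -
    Complex.sinh α ^ 2 * h2 + Complex.sinh β ^ 2 * h1

theorem exp_sq_of_sinh_sub_eq_zero {α β : ℂ} (h : Complex.sinh (α - β) = 0) :
    Complex.exp α ^ 2 = Complex.exp β ^ 2 := by
  rw [Complex.sinh, neg_sub, Complex.exp_sub, Complex.exp_sub] at h
  have h1 := Complex.exp_ne_zero α
  have h2 := Complex.exp_ne_zero β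
  field_simp at h
  linear_combination h

theorem sinh_sub_sq_of_left {α β : ℂ} (h : Complex.sinh α = 0) :
    Complex.sinh (α - β) ^ 2 = Complex.sinh β ^ 2 := by
  have := sinh_sq_of_sub_eq_zero (α := α - β) (β := -β) (by rw [sub_neg_eq_add, sub_add_cancel, h])
  rw [this, Complex.sinh_neg]; ring

theorem sinh_sub_sq_of_right {α β : ℂ} (h : Complex.sinh β = 0) :
    Complex.sinh (α - β) ^ 2 = Complex.sinh α ^ 2 :=
  (sinh_sq_of_sub_eq_zero (α := α) (β := α - β) (by rw [sub_sub_cancel, h])).symm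

/-- If one of the factors vanishes, some discriminant vanishes identically, against irreducibility.
In the hyperbolic and elliptic cases this uses that the other two values then have equal squares. -/
theorem Regular.good {E : BulkType} {α β : ℂ} (h : E.Regular α β) : E.Good α β := by
  have hirr := h.irreducible
  cases E
  case Q1 δ =>
    refine ⟨fun h0 => ?_, fun h0 => ?_, fun h0 => ?_⟩ <;> refine false_of_disc_eq_zero hirr ?_
    · left; intro x y; simp only [QuadCoeffs.disc, coeffs, h0]; ring
    · left; intro x y; simp only [QuadCoeffs.disc, coeffs, h0]; ring
    · right; left; intro x y; rw [sub_eq_zero] at h0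
      simp only [QuadCoeffs.disc, QuadCoeffs.swapVY, coeffs, h0]; ring
  case A1 δ =>
    refine ⟨fun h0 => ?_, fun h0 => ?_, fun h0 => ?_⟩ <;> refine false_of_disc_eq_zero hirr ?_
    · left; intro x y; simp only [QuadCoeffs.disc, coeffs, h0]; ring
    · left; intro x y; simp only [QuadCoeffs.disc, coeffs, h0]; ring
    · right; left; intro x y; rw [sub_eq_zero] at h0
      simp only [QuadCoeffs.disc, QuadCoeffs.swapVY, coeffs, h0]; ring
  case Q2 =>
    refine ⟨fun h0 => ?_, fun h0 => ?_, fun h0 => ?_⟩ <;> refine false_of_disc_eq_zero hirr ?_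
    · left; intro x y; simp only [QuadCoeffs.disc, coeffs, h0]; ring
    · left; intro x y; simp only [QuadCoeffs.disc, coeffs, h0]; ring
    · right; left; intro x y; rw [sub_eq_zero] at h0
      simp only [QuadCoeffs.disc, QuadCoeffs.swapVY, coeffs, h0]; ring
  case H1 =>
    intro h0
    refine false_of_disc_eq_zero hirr ?_
    right; left; intro x y; rw [sub_eq_zero] at h0
    simp only [QuadCoeffs.disc, QuadCoeffs.swapVY, coeffs, h0]; ring
  case H2 =>
    intro h0
    refine false_of_disc_eq_zero hirr ?_
    right; left; intro x y; rw [sub_eq_zero] at h0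
    simp only [QuadCoeffs.disc, QuadCoeffs.swapVY, coeffs, h0]; ring
  case H3 δ =>
    intro h0
    refine false_of_disc_eq_zero hirr ?_
    right; left; intro x y
    have h1 := exp_sq_of_sinh_sub_eq_zero h0
    simp only [QuadCoeffs.disc, QuadCoeffs.swapVY, coeffs, two_mul, Complex.exp_add]
    linear_combination -(x * y + δ * Complex.exp β) * h1
  case Q3 δ =>
    refine ⟨fun h0 => ?_, fun h0 => ?_, fun h0 => ?_⟩ <;> refine false_of_disc_eq_zero hirr ?_
    · left; intro x y; have h1 := sinh_sub_sq_of_left (β := β) h0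
      simp only [QuadCoeffs.disc, coeffs, h0]; linear_combination (x * y) * h1
    · left; intro x y; have h1 := sinh_sub_sq_of_right (α := α) h0
      simp only [QuadCoeffs.disc, coeffs, h0]; linear_combination (x * y) * h1
    · right; left; intro x y; have h1 := sinh_sq_of_sub_eq_zero h0
      simp only [QuadCoeffs.disc, QuadCoeffs.swapVY, coeffs, h0]; linear_combination -(x * y) * h1
  case A2 =>
    refine ⟨fun h0 => ?_, fun h0 => ?_, fun h0 => ?_⟩ <;> refine false_of_disc_eq_zero hirr ?_
    · right; left; intro x y; have h1 := sinh_sub_sq_of_left (β := β) h0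
      simp only [QuadCoeffs.disc, QuadCoeffs.swapVY, coeffs, h0]; linear_combination (x * y) * h1
    · right; right; intro x y; have h1 := sinh_sub_sq_of_right (α := α) h0
      simp only [QuadCoeffs.disc, QuadCoeffs.swapUY, coeffs, h0]; linear_combination (x * y) * h1
    · right; left; intro x y; have h1 := sinh_sq_of_sub_eq_zero h0
      simp only [QuadCoeffs.disc, QuadCoeffs.swapVY, coeffs, h0]; linear_combination (x * y) * h1
  case Q4 τ =>
    obtain ⟨hα, hβ, hαβ⟩ := h.1
    refine ⟨⟨hα, hβ, hαβ⟩, fun h0 => ?_, fun h0 => ?_, fun h0 => ?_⟩ <;>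
      refine false_of_disc_eq_zero hirr ?_
    · left; intro x y
      have h1 := jacobiSn_sq_eq_sq τ.im_pos hαβ hβ (by rwa [sub_add_cancel])
        (by rwa [sub_add_cancel])
      simp only [QuadCoeffs.disc, coeffs, h0]; linear_combination (x * y) * h1
    · left; intro x y
      have h1 := jacobiSn_sq_eq_sq τ.im_pos hα hαβ.neg (by simpa using hβ) (by simpa using h0)
      rw [jacobiSn_neg] at h1
      simp only [QuadCoeffs.disc, coeffs, h0]; linear_combination -(x * y) * h1
    · right; left; intro x y
      have h1 := jacobiSn_sq_eq_sq τ.im_pos hα hβ.neg (by rwa [← sub_eq_add_neg])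
        (by rwa [← sub_eq_add_neg])
      rw [jacobiSn_neg] at h1
      simp only [QuadCoeffs.disc, QuadCoeffs.swapVY, coeffs, h0]; linear_combination -(x * y) * h1

/-- Otherwise the prefactor `θ₃(0) / θ₂(0)` is zero (division by zero has the value `0`), and `sn`
would vanish identically. -/
theorem Good.theta_ne_zero {τ : UpperHalfPlane} {α β : ℂ} (h : (Q4 τ).Good α β) :
    theta2 τ 0 ≠ 0 ∧ theta3 τ 0 ≠ 0 := by
  have h1 := h.2.1
  constructor <;> intro h0 <;> simp [jacobiSn, h0] at h1

/-- The coefficients `a, b, c` of the tetrahedron polynomial depend only on the differences of the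
three parameters, and these are controlled by the three pairs. Nonzero `a, b, c` suffice for
irreducibility. -/
theorem Good.regular_tetrahedron {E : BulkType} {α β γ : ℂ} (hαβ : E.Good α β) (hβγ : E.Good β γ)
    (hαγ : E.Good α γ) : E.tetrahedron.Regular (α - β) (γ - β) := by
  rw [Regular, poly_eq]
  have e : α - β - (γ - β) = α - γ := by ring
  cases E
  case Q4 τ =>
    have hγβ := hβγ.comm
    refine ⟨⟨hαβ.1.2.2, hγβ.1.2.2, by rw [e]; exact hαγ.1.2.2⟩,
      QuadCoeffs.irreducible_poly ?_ ?_ ?_⟩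
    · exact hαβ.2.2.2
    · exact neg_ne_zero.2 hγβ.2.2.2
    · rw [tetrahedron, coeffs]; simp only [e]; exact neg_ne_zero.2 hαγ.2.2.2
  all_goals
    refine ⟨trivial, QuadCoeffs.irreducible_poly ?_ ?_ ?_⟩
  all_goals
    have hγβ := hβγ.comm
    simp only [tetrahedron, coeffs, e, neg_ne_zero, neg_sub, sub_sub_sub_cancel_right]
    simp only [Good] at hαβ hγβ hαγ hβγ
    first
      | exact hαβ
      | exact hβγ
      | exact hβγ.2.2
      | exact hγβ
      | exact hαγ
      | exact hαβ.2.2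
      | exact hγβ.2.2
      | exact hαγ.2.2
      | exact sub_ne_zero.2 (sub_ne_zero.1 hαγ).symm
      | exact sub_ne_zero.2 (sub_ne_zero.1 hαγ.2.2).symm

end BulkType

/-! ### Elimination of a common vertex -/

/-- The resultant of two affine-linear functions. -/
def affRes (f g : ℂ → ℂ) : ℂ := f 0 * g 1 - f 1 * g 0

/-- `f` is affine-linear. -/
def IsAffine (f : ℂ → ℂ) : Prop := ∀ t, f t = f 0 + (f 1 - f 0) * t

theorem affRes_eq_zero {f g : ℂ → ℂ} (hf : IsAffine f) (hg : IsAffine g) {t : ℂ} (h1 : f t = 0)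
    (h2 : g t = 0) : affRes f g = 0 := by
  have e1 := hf t
  have e2 := hg t
  rw [h1] at e1
  rw [h2] at e2
  rw [affRes]
  linear_combination (g 0 - g 1) * e1 - (f 0 - f 1) * e2

/-- The nonzero slope excludes that the resultant vanishes merely because `f` has no linear term. -/
theorem eq_zero_of_affRes {f g : ℂ → ℂ} (hf : IsAffine f) (hg : IsAffine g) (h : affRes f g = 0)
    {t : ℂ} (h1 : f t = 0) (hne : f 1 - f 0 ≠ 0) : g t = 0 := by
  have e1 := hf t
  rw [h1] at e1
  rw [affRes] at h
  apply (mul_eq_zero.1 _).resolve_left hne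
  rw [hg t]
  linear_combination -h - (g 1 - g 0) * e1

theorem IsUniqueZero.slope_ne_zero {f : ℂ → ℂ} (hf : IsAffine f) {t : ℂ} (h : IsUniqueZero f t) :
    f 1 - f 0 ≠ 0 := by
  intro h0
  have ht := (h t).2 rfl
  have : f (t + 1) = 0 := by rw [hf, h0]; rw [hf, h0] at ht; linear_combination ht
  have := (h _).1 this
  simp at this

theorem isUniqueZero_of_slope_ne_zero {f : ℂ → ℂ} (hf : IsAffine f) {t : ℂ} (ht : f t = 0)
    (h : f 1 - f 0 ≠ 0) : IsUniqueZero f t := by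
  refine fun b => ⟨fun hb => ?_, fun hb => hb ▸ ht⟩
  have e1 := hf t
  have e2 := hf b
  rw [ht] at e1
  rw [hb] at e2
  apply mul_left_cancel₀ h
  linear_combination e1 - e2

theorem QuadCoeffs.isAffine_val_three (q : QuadCoeffs) (x u y : ℂ) :
    IsAffine fun t => q.val x u t y := fun t => by simp only [QuadCoeffs.val]; ring

theorem QuadCoeffs.isAffine_val_four (q : QuadCoeffs) (x u v : ℂ) :
    IsAffine fun t => q.val x u v t := fun t => by simp only [QuadCoeffs.val]; ring

theorem QuadCoeffs.isAffine_val_two (q : QuadCoeffs) (x v y : ℂ) :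
    IsAffine fun t => q.val x t v y := fun t => by simp only [QuadCoeffs.val]; ring

namespace BulkType

theorem isAffine_Q_two (E : BulkType) (x v y α β : ℂ) : IsAffine fun t => E.Q x t v y α β := by
  simpa only [Q_eq] using (E.coeffs α β).isAffine_val_two x v y

theorem isAffine_Q_three (E : BulkType) (x u y α β : ℂ) : IsAffine fun t => E.Q x u t y α β := by
  simpa only [Q_eq] using (E.coeffs α β).isAffine_val_three x u y

theorem isAffine_Q_four (E : BulkType) (x u v α β : ℂ) : IsAffine fun t => E.Q x u v t α β := by
  simpa only [Q_eq] using (E.coeffs α β).isAffine_val_four x u v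

theorem sinh_sub_eq (α β : ℂ) : Complex.sinh (α - β) =
    (Complex.exp α ^ 2 - Complex.exp β ^ 2) / (2 * Complex.exp α * Complex.exp β) := by
  have h1 := Complex.exp_ne_zero α
  have h2 := Complex.exp_ne_zero β
  rw [Complex.sinh, neg_sub, Complex.exp_sub, Complex.exp_sub]
  field_simp

theorem sinh_eq_exp (α : ℂ) :
    Complex.sinh α = (Complex.exp α ^ 2 - 1) / (2 * Complex.exp α) := by
  have h := sinh_sub_eq α 0
  simpa using h

/-- Together with the next identity, the hyperbolic counterpart of the two `sn` identities; these
are the relations that the tetrahedron property needs for Q3 and A2. -/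
theorem sinh_three_arguments (α β γ : ℂ) :
    Complex.sinh α * Complex.sinh γ * Complex.sinh (α - γ) +
        Complex.sinh (α - β) * Complex.sinh (β - γ) * Complex.sinh (α - γ) =
      Complex.sinh α * Complex.sinh β * Complex.sinh (α - β) +
        Complex.sinh β * Complex.sinh γ * Complex.sinh (β - γ) := by
  rw [sinh_sub_eq α γ, sinh_sub_eq α β, sinh_sub_eq β γ, sinh_eq_exp α, sinh_eq_exp β,
    sinh_eq_exp γ]
  have h1 := Complex.exp_ne_zero α
  have h2 := Complex.exp_ne_zero β
  have h3 := Complex.exp_ne_zero γ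
  field_simp
  ring

theorem sinh_three_arguments' (α β γ : ℂ) :
    Complex.sinh α * Complex.sinh (β - γ) + Complex.sinh γ * Complex.sinh (α - β) =
      Complex.sinh β * Complex.sinh (α - γ) := by
  simp only [Complex.sinh_sub]; ring

/-- The tetrahedron property: two faces that share the edge from `v` to `u₂` are, after elimination
of `u₂`, equivalent to the third face at `v` together with the tetrahedron equation. -/
theorem exists_affRes_tetrahedron (E : BulkType) {α β γ : ℂ} (hαβ : E.Good α β)
    (hβγ : E.Good β γ) (hαγ : E.Good α γ) : ∃ κ κ' : ℂ, κ ≠ 0 ∧ κ' ≠ 0 ∧ ∀ v u₁ u₃ x y,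
      κ * affRes (fun t => E.Q v u₁ t x α β) (fun t => E.Q v t u₃ y β γ) =
        κ' * affRes (fun t => E.Q v u₁ u₃ t α γ)
          (fun t => E.tetrahedron.Q v x y t (α - β) (γ - β)) := by
  have e : α - β - (γ - β) = α - γ := by ring
  cases E
  case Q1 δ =>
    -- In all cases `κ` is the coefficient function of the tetrahedron equation (identity, `sinh` or
    -- `sn`) at `α - γ`. Up to sign, `κ'` is the corresponding coefficient of `Q` at the shared
    -- parameter `β`, which is `1` for H1 and H2 and `exp β` for H3.
    refine ⟨α - γ, -β, hαγ.2.2, neg_ne_zero.2 hαβ.2.1, fun v u₁ u₃ x y => ?_⟩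
    simp only [affRes, Q_eq, QuadCoeffs.val, tetrahedron, coeffs]; ring
  case Q2 =>
    refine ⟨α - γ, -β, hαγ.2.2, neg_ne_zero.2 hαβ.2.1, fun v u₁ u₃ x y => ?_⟩
    simp only [affRes, Q_eq, QuadCoeffs.val, tetrahedron, coeffs]; ring
  case A1 δ =>
    refine ⟨α - γ, -β, hαγ.2.2, neg_ne_zero.2 hαβ.2.1, fun v u₁ u₃ x y => ?_⟩
    simp only [affRes, Q_eq, QuadCoeffs.val, tetrahedron, coeffs]; ring
  case H1 =>
    refine ⟨α - γ, -1, hαγ, by norm_num, fun v u₁ u₃ x y => ?_⟩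
    simp only [affRes, Q_eq, QuadCoeffs.val, tetrahedron, coeffs]; ring
  case H2 =>
    refine ⟨α - γ, -1, hαγ, by norm_num, fun v u₁ u₃ x y => ?_⟩
    simp only [affRes, Q_eq, QuadCoeffs.val, tetrahedron, coeffs]; ring
  case Q3 δ =>
    refine ⟨Complex.sinh (α - γ), -Complex.sinh β, hαγ.2.2, neg_ne_zero.2 hαβ.2.1,
      fun v u₁ u₃ x y => ?_⟩
    have R1 := sinh_three_arguments α β γ
    have R2 := sinh_three_arguments' α β γ
    simp only [affRes, Q_eq, QuadCoeffs.val, tetrahedron, coeffs, e, sinh_sub_comm β γ]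
    linear_combination v * (-u₁ * y + u₃ * x - δ * Complex.sinh β * Complex.sinh (α - γ)) * R1 +
      v * (-Complex.sinh (α - γ) * u₁ * u₃ + Complex.sinh β * u₁ * x +
        Complex.sinh (α - γ) * x * y - Complex.sinh β * u₃ * y) * R2
  case A2 =>
    refine ⟨Complex.sinh (α - γ), Complex.sinh β, hαγ.2.2, hαβ.2.1, fun v u₁ u₃ x y => ?_⟩
    have R1 := sinh_three_arguments α β γ
    have R2 := sinh_three_arguments' α β γ
    simp only [affRes, Q_eq, QuadCoeffs.val, tetrahedron, coeffs, e, sinh_sub_comm β γ]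
    linear_combination v * (-u₁ * x + u₃ * y) * R1 + v * (Complex.sinh β * u₁ * y -
      Complex.sinh (α - γ) * u₁ * u₃ * x * y + Complex.sinh (α - γ) - Complex.sinh β * u₃ * x) * R2
  case H3 δ =>
    refine ⟨Complex.sinh (α - γ), -Complex.exp β, hαγ, neg_ne_zero.2 (Complex.exp_ne_zero _),
      fun v u₁ u₃ x y => ?_⟩
    simp only [affRes, Q_eq, QuadCoeffs.val, tetrahedron, coeffs, e, sinh_sub_comm β γ, sinh_sub_eq,
      two_mul, Complex.exp_add]
    have h1 := Complex.exp_ne_zero α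
    have h2 := Complex.exp_ne_zero β
    have h3 := Complex.exp_ne_zero γ
    field_simp
    ring
  case Q4 τ =>
    refine ⟨jacobiSn τ (α - γ), -jacobiSn τ β, hαγ.2.2.2, neg_ne_zero.2 hαβ.2.2.1,
      fun v u₁ u₃ x y => ?_⟩
    obtain ⟨t2, t3⟩ := hαβ.theta_ne_zero
    have R1 := jacobiSn_three_arguments τ.im_pos hαβ.1.1 hαβ.1.2.1 hβγ.1.2.1 hαβ.1.2.2 hβγ.1.2.2
      hαγ.1.2.2
    have R2 := jacobiSn_three_arguments' τ.im_pos t2 t3 hαβ.1.1 hαβ.1.2.1 hβγ.1.2.1 hαβ.1.2.2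
      hβγ.1.2.2 hαγ.1.2.2
    simp only [affRes, Q_eq, QuadCoeffs.val, tetrahedron, coeffs, e, jacobiSn_sub_comm _ β γ]
    linear_combination v * (-u₁ * y + u₃ * x - jacobiSn τ β * jacobiSn τ (α - γ) +
        jacobiSn τ β * jacobiSn τ (α - γ) * ellipticModulus τ ^ 2 * (u₁ * u₃ * x * y)) * R1 +
      v * (-jacobiSn τ (α - γ) * u₁ * u₃ + jacobiSn τ β * u₁ * x +
        jacobiSn τ (α - γ) * x * y - jacobiSn τ β * u₃ * y) * R2

/-- For equations of Q-type, the elimination of a common vertex of two faces, the parameters of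
which are in involution, is symmetric in the opposite vertices. -/
theorem affRes_symm_of_involution {E : BulkType} (hE : E.tetrahedron = E) {α β : ℂ}
    (hm : E.Good α (α - β)) (hp : E.Good α (α + β)) (u m s w n : ℂ) :
    affRes (fun t => E.Q u t m s α (α + β)) (fun t => E.Q u t w n α (α - β)) =
      affRes (fun t => E.Q u t m n α (α + β)) (fun t => E.Q u t w s α (α - β)) := by
  have e1 : α - (α - β) = β := by ring
  have e2 : α - (α + β) = -β := by ring
  cases E <;> simp only [tetrahedron, reduceCtorEq] at hE
  case Q1 δ => simp only [affRes, Q_eq, QuadCoeffs.val, coeffs]; ring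
  case Q2 => simp only [affRes, Q_eq, QuadCoeffs.val, coeffs]; ring
  case Q3 δ =>
    simp only [affRes, Q_eq, QuadCoeffs.val, coeffs, e1, e2, Complex.sinh_neg]
    have h : Complex.sinh (α + β) * Complex.sinh (α - β) =
        Complex.sinh α ^ 2 - Complex.sinh β ^ 2 := by
      rw [Complex.sinh_add, Complex.sinh_sub]
      linear_combination Complex.sinh α ^ 2 * Complex.cosh_sq β -
        Complex.sinh β ^ 2 * Complex.cosh_sq α
    -- The exchange of `s` and `n` changes the resultant only by this multiple of the addition
    -- formula `h`.
    linear_combination (n - s) * u * (w + m) * h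
  case Q4 τ =>
    obtain ⟨t2, t3⟩ := hm.theta_ne_zero
    have hβ := hm.1.2.2
    rw [e1] at hβ
    have h := jacobiSn_mul_add_sub τ.im_pos t2 t3 hm.1.1 hβ hp.1.2.1 hm.1.2.1
    simp only [affRes, Q_eq, QuadCoeffs.val, coeffs, e1, e2, jacobiSn_neg]
    linear_combination (n - s) * u * (w + m) * h

end BulkType

/-! ### Nondegeneracy of dual boundary polynomials -/

theorem pderiv_rename_of_notMem_range {σ ι : Type*} {f : σ → ι} {i : ι} (hi : i ∉ Set.range f)
    (p : MvPolynomial σ ℂ) : pderiv i (rename f p) = 0 := by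
  classical
  refine pderiv_eq_zero_of_notMem_vars fun h => hi ?_
  obtain ⟨j, -, hj⟩ := Finset.mem_image.1 (vars_rename f p h)
  exact ⟨j, hj⟩

/-- `f f_{ij} - f_i f_j`. -/
def discr {σ : Type*} (i j : σ) (f : MvPolynomial σ ℂ) : MvPolynomial σ ℂ :=
  f * pderiv i (pderiv j f) - pderiv i f * pderiv j f

theorem discr_mul_of_pderiv_eq_zero {σ : Type*} {i j : σ} {g : MvPolynomial σ ℂ}
    (hg : pderiv j g = 0) (f : MvPolynomial σ ℂ) : discr i j (g * f) = g ^ 2 * discr i j f := by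
  have : pderiv j (pderiv i g) = 0 := by rw [pderiv_comm, hg, map_zero]
  simp only [discr, pderiv_mul, hg, zero_mul, zero_add]
  ring

theorem discr_rename {σ ι : Type*} {f : σ → ι} (hf : Function.Injective f) (i j : σ)
    (p : MvPolynomial σ ℂ) : discr (f i) (f j) (rename f p) = rename f (discr i j p) := by
  simp only [discr, pderiv_rename hf, map_sub, map_mul]

theorem injective_xuy : Function.Injective (![0, 1, 3] : Fin 3 → Fin 4) := by decide

theorem injective_uxv : Function.Injective (![1, 0, 2] : Fin 3 → Fin 4) := by decide

theorem IsBoundaryPolynomial.pderiv_ne_zero {q : MvPolynomial (Fin 3) ℂ} {i : Fin 3}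
    (h : degreeOf i q = 1) : pderiv i q ≠ 0 := by
  rw [Ne, pderiv_eq_zero_iff_degreeOf, h]; exact one_ne_zero

theorem discr_ne_zero_of_degreeOf {q : MvPolynomial (Fin 3) ℂ} (h : Irreducible q)
    (h0 : degreeOf 0 q = 1) (h2 : degreeOf 2 q = 1) : discr 0 2 q ≠ 0 :=
  discr_ne_zero_of_irreducible (by decide) h (pderiv_pderiv_of_degreeOf_le_one h0.le)
    (pderiv_pderiv_of_degreeOf_le_one h2.le) (IsBoundaryPolynomial.pderiv_ne_zero h0)
    (IsBoundaryPolynomial.pderiv_ne_zero h2)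

/-- A polynomial whose value vanishes wherever the irreducible polynomial `q` does is a multiple
of `q`. -/
theorem dvd_of_eval_eq_zero {n : ℕ} {q h : MvPolynomial (Fin n) ℂ} (hq : Irreducible q)
    (H : ∀ p, eval p q = 0 → eval p h = 0) : q ∣ h := by
  have hprime : (Ideal.span {q}).IsPrime :=
    (Ideal.span_singleton_prime hq.ne_zero).2 hq.prime
  rw [← Ideal.mem_span_singleton, ← hprime.radical,
    ← vanishingIdeal_zeroLocus_eq_radical (K := ℂ), mem_vanishingIdeal_iff]
  intro x hx
  have := (mem_zeroLocus_iff.1 hx) q (Ideal.mem_span_singleton_self q)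
  exact H x this

/-- Compare the discriminants in `u, v` of both sides of the duality relation. The side `χ p` has a
nonzero one; each kind of degeneracy of `q` makes the other vanish. -/
theorem nondegenerate_of_isDualPair {E : BulkType} {q p : TriFamily} (h : IsDualPair E q p) :
    Nondegenerate E q := by
  obtain ⟨hq, hp, χ, hχ⟩ := h
  intro α β hreg
  obtain ⟨hqi, hq0, hq2⟩ := hq.1 α β hreg
  obtain ⟨hpi, hp0, hp2⟩ := hp.1 α β hreg
  have hdual := hχ α β hreg
  have hQ := hreg.irreducible
  rw [← E.poly_eq] at hQ
  have hQQ : ∀ i, pderiv i (pderiv i (E.poly α β)) = 0 := by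
    rw [E.poly_eq]; exact QuadCoeffs.pderiv_pderiv_poly _
  have hQ23 : discr 2 3 (E.poly α β) ≠ 0 := by
    rw [E.poly_eq]; exact QuadCoeffs.discr_poly_ne_zero hreg.irreducible (by decide)
  have hX2 : pderiv 2 (rename ![0, 1] (χ α β) : MvPolynomial (Fin 4) ℂ) = 0 :=
    pderiv_rename_of_notMem_range (by decide) _
  have hX3 : pderiv 3 (rename ![0, 1] (χ α β) : MvPolynomial (Fin 4) ℂ) = 0 :=
    pderiv_rename_of_notMem_range (by decide) _
  have hq2' : pderiv 2 (onXUY (q α β)) = 0 := pderiv_rename_of_notMem_range (by decide) _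
  have hp3' : pderiv 3 (onUXV (p α β)) = 0 := pderiv_rename_of_notMem_range (by decide) _
  have e3 : pderiv 3 (onXUY (q α β)) = rename ![0, 1, 3] (pderiv 2 (q α β)) :=
    pderiv_rename injective_xuy 2 _
  have e1 : pderiv 1 (onXUY (q α β)) = rename ![0, 1, 3] (pderiv 1 (q α β)) :=
    pderiv_rename injective_xuy 1 _
  have hq3ne : pderiv 3 (onXUY (q α β)) ≠ 0 := by
    rw [e3]
    exact (map_ne_zero_iff _ (rename_injective _ injective_xuy)).2
      (IsBoundaryPolynomial.pderiv_ne_zero hq2)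
  have hq33 : pderiv 3 (pderiv 3 (onXUY (q α β))) = 0 := by
    rw [e3]
    have : pderiv 3 (rename ![0, 1, 3] (pderiv 2 (q α β)) : MvPolynomial (Fin 4) ℂ) =
      rename ![0, 1, 3] (pderiv 2 (pderiv 2 (q α β))) := pderiv_rename injective_xuy 2 _
    rw [this, pderiv_pderiv_of_degreeOf_le_one hq2.le, map_zero]
  have hpd : discr 1 2 (onUXV (p α β)) ≠ 0 := by
    have : discr 1 2 (onUXV (p α β)) = rename ![1, 0, 2] (discr 0 2 (p α β)) :=
      discr_rename injective_uxv 0 2 _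
    rw [this]
    exact (map_ne_zero_iff _ (rename_injective _ injective_uxv)).2
      (discr_ne_zero_of_degreeOf hpi hp0 hp2)
  have heval : ∀ x u v y : ℂ, eval ![x, u, v, y] (onXUY (q α β)) = eval ![x, u, y] (q α β) := by
    intro x u v y
    rw [onXUY, eval_rename]
    congr 2
    ext i; fin_cases i <;> rfl
  have hdegI : ∀ x u v y : ℂ, eval ![x, u, v, y] (deltaUV (E.poly α β)) =
      (E.coeffs α β).disc x y := by
    intro x u v y
    rw [E.poly_eq]
    exact QuadCoeffs.eval_discr_one_two _ x u v y
  rw [eliminant] at hdual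
  revert hdual
  generalize (rename ![0, 1] (χ α β) : MvPolynomial (Fin 4) ℂ) = R at *
  generalize hqq : onXUY (q α β) = r at *
  generalize onUXV (p α β) = s at *
  generalize hPQ : E.poly α β = Q at *
  intro hdual
  -- If `χ = 0`, then `Q q_y = Q_y q`. Differentiating in `v` and eliminating `q` gives `q_y (Q
  -- Q_{vy} - Q_v Q_y) = 0`.
  have hR : R ≠ 0 := by
    rintro rfl
    rw [zero_mul] at hdual
    have hd := congrArg (pderiv 2) hdual
    have hr32 : pderiv 2 (pderiv 3 r) = 0 := by rw [pderiv_comm, hq2', map_zero]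
    rw [map_sub, pderiv_mul, pderiv_mul, hr32, hq2', map_zero] at hd
    apply mul_ne_zero hq3ne hQ23
    rw [discr]
    linear_combination pderiv 2 (pderiv 3 Q) * hdual - pderiv 3 Q * hd
  have hdisc : discr 1 2 (Q * pderiv 3 r - pderiv 3 Q * r) = R ^ 2 * discr 1 2 s := by
    rw [hdual, discr_mul_of_pderiv_eq_zero hX2]
  have hG : R ^ 2 * discr 1 2 s ≠ 0 := mul_ne_zero (pow_ne_zero _ hR) hpd
  have hr32 : pderiv 2 (pderiv 3 r) = 0 := by rw [pderiv_comm, hq2', map_zero]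
  refine ⟨fun hI => ?_, fun hII => ?_⟩
  -- Degeneracy (i) makes `q` divide `δ_{u,v} Q`, a nonzero polynomial in `x, y` alone. Hence `q`
  -- does not involve `u`.
  · have hr1 : pderiv 1 r = 0 := by
      obtain ⟨D, hD⟩ : ∃ D : MvPolynomial (Fin 3) ℂ, D =
        (C (E.coeffs α β).c * (X 0 * X 2) + C (E.coeffs α β).l * (X 0 + X 2)
          + C (E.coeffs α β).k) * (C (E.coeffs α β).c + C (E.coeffs α β).m * (X 0 * X 2))
        - (C (E.coeffs α β).a * X 0 + C (E.coeffs α β).b * X 2 + C (E.coeffs α β).l) *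
          (C (E.coeffs α β).a * X 2 + C (E.coeffs α β).b * X 0 + C (E.coeffs α β).l) := ⟨_, rfl⟩
      have hDe : ∀ z : Fin 3 → ℂ, eval z D = (E.coeffs α β).disc (z 0) (z 2) := by
        intro z; rw [hD]; simp [QuadCoeffs.disc]
      have hdvd : q α β ∣ D := by
        refine dvd_of_eval_eq_zero hqi fun z hz => ?_
        rw [hDe, ← hdegI (z 0) (z 1) 0 (z 2)]
        apply hI
        rw [← hz]
        congr 2
        ext i; fin_cases i <;> rfl
      have hD0 : D ≠ 0 := by
        obtain ⟨x, y, hxy⟩ := QuadCoeffs.exists_disc_ne_zero hreg.irreducible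
        rintro rfl
        exact hxy (by simpa using (hDe ![x, 0, y]).symm)
      obtain ⟨g, hg⟩ := hdvd
      have hD1 : pderiv 1 D = 0 := by
        rw [hD]
        simp only [map_sub, map_add, pderiv_mul, pderiv_C, pderiv_X, Pi.single_apply, Fin.reduceEq,
          ↓reduceIte]
        ring
      have hg0 : g ≠ 0 := by rintro rfl; exact hD0 (by rw [hg, mul_zero])
      have hq1 : pderiv 1 (q α β) = 0 :=
        pderiv_eq_zero_of_mul_left hg0 (by rw [mul_comm, ← hg, hD1])
      rw [e1, hq1, map_zero]
    have hr31 : pderiv 1 (pderiv 3 r) = 0 := by rw [pderiv_comm, hr1, map_zero]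
    -- Modulo `q`, the discriminant is `q_y² δ_{u,v} Q`, which vanishes where `q` does.
    have hdisc' : discr 1 2 (Q * pderiv 3 r - pderiv 3 Q * r) =
        (pderiv 3 r) ^ 2 * deltaUV Q + r * (-pderiv 3 r * (Q * pderiv 1 (pderiv 2 (pderiv 3 Q))
          + pderiv 3 Q * pderiv 1 (pderiv 2 Q)) + r * (pderiv 3 Q * pderiv 1 (pderiv 2 (pderiv 3 Q)))
          + pderiv 3 r * (pderiv 1 Q * pderiv 2 (pderiv 3 Q) + pderiv 2 Q * pderiv 1 (pderiv 3 Q))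
          - r * (pderiv 1 (pderiv 3 Q) * pderiv 2 (pderiv 3 Q))) := by
      simp only [discr, deltaUV, map_sub, pderiv_mul, hr1, hq2', hr31, hr32, mul_zero,
        add_zero]
      ring
    have hG3 : pderiv 3 (R ^ 2 * discr 1 2 s) = 0 := by
      have h1 : pderiv 3 (pderiv 1 s) = 0 := by rw [pderiv_comm, hp3', map_zero]
      have h2 : pderiv 3 (pderiv 2 s) = 0 := by rw [pderiv_comm, hp3', map_zero]
      have h12 : pderiv 3 (pderiv 1 (pderiv 2 s)) = 0 := by rw [pderiv_comm, h2, map_zero]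
      simp only [discr, pow_two, pderiv_mul, map_sub, hX3, hp3', h1, h2, h12]
      ring
    obtain ⟨z, hz⟩ := QuadCoeffs.exists_eval_ne_zero (mul_ne_zero hG hq3ne)
    rw [map_mul] at hz
    have hz1 := left_ne_zero_of_mul hz
    have hz2 := right_ne_zero_of_mul hz
    -- The discriminant of `χ p` is free of `y`. Moving `y` to the root of `q` leaves its nonzero
    -- value unchanged, yet it must vanish there.
    have hr0 := eval_update_of_affine hq33 z (z 3 - eval z r / eval z (pderiv 3 r))
    have hrz : eval (Function.update z 3 (z 3 - eval z r / eval z (pderiv 3 r))) r = 0 := by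
      rw [hr0]; field_simp; ring
    have hGz := eval_update_of_pderiv_eq_zero hG3 z (z 3 - eval z r / eval z (pderiv 3 r))
    apply hz1
    rw [← hGz, ← hdisc, hdisc']
    generalize Function.update z 3 (z 3 - eval z r / eval z (pderiv 3 r)) = w at *
    rw [QuadCoeffs.eta_fin_four w] at hrz ⊢
    rw [heval] at hrz
    have := hI _ _ (w 2) _ hrz
    rw [map_add, map_mul, map_mul _ r, this, heval, hrz]
    ring
  · obtain ⟨c₀, c₁, hc⟩ := hII
    rw [hqq] at hc
    apply hG
    rw [← hdisc]
    -- Under degeneracy (ii), `H` is a function of `v` alone times one free of `v`. Such a product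
    -- has zero discriminant in `u, v`.
    have hH : Q * pderiv 3 r - pderiv 3 Q * r = (C c₀ - C c₁ * X 2) *
        (Q * pderiv 3 (pderiv 2 Q) - pderiv 3 Q * pderiv 2 Q) := by
      rw [hc]
      simp only [map_add, map_sub, pderiv_mul, pderiv_C, pderiv_X_of_ne (show (2 : Fin 4) ≠ 3 by decide)]
      ring
    have hW : pderiv 2 (Q * pderiv 3 (pderiv 2 Q) - pderiv 3 Q * pderiv 2 Q) = 0 := by
      have h23 : pderiv 2 (pderiv 3 Q) = pderiv 3 (pderiv 2 Q) := pderiv_comm _ _ _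
      have h232 : pderiv 2 (pderiv 3 (pderiv 2 Q)) = 0 := by rw [pderiv_comm, hQQ, map_zero]
      simp only [map_sub, pderiv_mul, h23, h232, hQQ]; ring
    rw [hH, mul_comm, discr_mul_of_pderiv_eq_zero hW, discr]
    simp [pderiv_X]

/-! ### Properties that hold for generic triples -/

/-- The property holds outside the zero set of a nonzero polynomial. -/
def Generically (P : ℂ → ℂ → ℂ → Prop) : Prop :=
  ∃ D : MvPolynomial (Fin 3) ℂ, D ≠ 0 ∧ ∀ x y u : ℂ, eval ![x, y, u] D ≠ 0 → P x y u

namespace Generically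

theorem mono {P R : ℂ → ℂ → ℂ → Prop} (h : Generically P) (hPR : ∀ x y u, P x y u → R x y u) :
    Generically R := by
  obtain ⟨D, hD, H⟩ := h
  exact ⟨D, hD, fun x y u h => hPR _ _ _ (H x y u h)⟩

theorem and {P R : ℂ → ℂ → ℂ → Prop} (h : Generically P) (h' : Generically R) :
    Generically fun x y u => P x y u ∧ R x y u := by
  obtain ⟨D, hD, H⟩ := h
  obtain ⟨D', hD', H'⟩ := h'
  refine ⟨D * D', mul_ne_zero hD hD', fun x y u h => ?_⟩
  rw [map_mul] at h
  exact ⟨H _ _ _ (left_ne_zero_of_mul h), H' _ _ _ (right_ne_zero_of_mul h)⟩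

theorem of_eval_ne_zero {D : MvPolynomial (Fin 3) ℂ} (h : D ≠ 0) :
    Generically fun x y u => eval ![x, y, u] D ≠ 0 :=
  ⟨D, h, fun _ _ _ h => h⟩

theorem swap_last {P : ℂ → ℂ → ℂ → Prop} (h : Generically P) :
    Generically fun x y u => P x u y := by
  obtain ⟨D, hD, H⟩ := h
  refine ⟨rename ![0, 2, 1] D, ?_, fun x y u h => H _ _ _ ?_⟩
  · exact (map_ne_zero_iff _ (rename_injective _ (by decide))).2 hD
  · rw [eval_rename] at h
    convert h using 3
    ext i; fin_cases i <;> rfl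

theorem swap_outer {P : ℂ → ℂ → ℂ → Prop} (h : Generically P) :
    Generically fun x y u => P u y x := by
  obtain ⟨D, hD, H⟩ := h
  refine ⟨rename ![2, 1, 0] D, ?_, fun x y u h => H _ _ _ ?_⟩
  · exact (map_ne_zero_iff _ (rename_injective _ (by decide))).2 hD
  · rw [eval_rename] at h
    convert h using 3
    ext i; fin_cases i <;> rfl

theorem swap_first {P : ℂ → ℂ → ℂ → Prop} (h : Generically P) :
    Generically fun x y u => P y x u := by
  obtain ⟨D, hD, H⟩ := h
  refine ⟨rename ![1, 0, 2] D, ?_, fun x y u h => H _ _ _ ?_⟩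
  · exact (map_ne_zero_iff _ (rename_injective _ (by decide))).2 hD
  · rw [eval_rename] at h
    convert h using 3
    ext i; fin_cases i <;> rfl

end Generically

theorem eval_rename_fin_two (s : MvPolynomial (Fin 2) ℂ) (x y u : ℂ) :
    eval ![x, y, u] (rename ![0, 1] s) = eval ![x, y] s := by
  rw [eval_rename]
  congr 2
  ext i; fin_cases i <;> rfl

theorem eta_fin_three (p : Fin 3 → ℂ) : p = ![p 0, p 1, p 2] := by
  ext i; fin_cases i <;> rfl

theorem eval_fin_three (D : MvPolynomial (Fin 3) ℂ) (x y u : ℂ) : eval ![x, y, u] D =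
    ∑ m ∈ D.support, coeff m D * (x ^ m 0 * y ^ m 1 * u ^ m 2) := by
  rw [eval_eq']
  simp [Fin.prod_univ_three]

/-- If `v` is determined by `x, y, u` through a relation that is affine-linear and nonsingular in
`u` and `v`, then the triple `x, y, v` is generic if `x, y, u` is. -/
theorem Generically.step {s₀ s₁ t₀ t₁ : MvPolynomial (Fin 2) ℂ} (hs : s₀ * t₁ - s₁ * t₀ ≠ 0)
    {F : ℂ → ℂ → ℂ → ℂ → ℂ} (hF : ∀ x y u v, F x y u v = eval ![x, y] s₀ + eval ![x, y] s₁ * u +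
      eval ![x, y] t₀ * v + eval ![x, y] t₁ * (u * v))
    {P : ℂ → ℂ → ℂ → Prop} (hP : Generically P) :
    Generically fun x y u => ∃ v, IsUniqueZero (F x y u) v ∧ P x y v := by
  obtain ⟨D, hD, H⟩ := hP
  obtain ⟨S, hS⟩ : ∃ S : MvPolynomial (Fin 3) ℂ,
    S = rename ![0, 1] s₀ + rename ![0, 1] s₁ * X 2 := ⟨_, rfl⟩
  obtain ⟨T, hT⟩ : ∃ T : MvPolynomial (Fin 3) ℂ,
    T = rename ![0, 1] t₀ + rename ![0, 1] t₁ * X 2 := ⟨_, rfl⟩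
  have hSe : ∀ x y u, eval ![x, y, u] S = eval ![x, y] s₀ + eval ![x, y] s₁ * u := by
    intro x y u; rw [hS]; simp [eval_rename_fin_two]
  have hTe : ∀ x y u, eval ![x, y, u] T = eval ![x, y] t₀ + eval ![x, y] t₁ * u := by
    intro x y u; rw [hT]; simp [eval_rename_fin_two]
  -- The relation gives `v = -S / T`, and `N` is the numerator of `D(x, y, -S / T)`.
  obtain ⟨N, hN⟩ : ∃ N : MvPolynomial (Fin 3) ℂ, N = ∑ m ∈ D.support, C (coeff m D) *
    (X 0 ^ m 0 * X 1 ^ m 1 * ((-S) ^ m 2 * T ^ (degreeOf 2 D - m 2))) := ⟨_, rfl⟩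
  have hNe : ∀ x y u, eval ![x, y, u] T ≠ 0 → eval ![x, y, u] N =
      eval ![x, y, u] T ^ degreeOf 2 D *
        eval ![x, y, -eval ![x, y, u] S / eval ![x, y, u] T] D := by
    intro x y u hne
    rw [hN, eval_fin_three D, map_sum, Finset.mul_sum]
    refine Finset.sum_congr rfl fun m hm => ?_
    have hle : m 2 ≤ degreeOf 2 D := degreeOf_le_iff.1 le_rfl m hm
    have : eval ![x, y, u] T ^ degreeOf 2 D =
        eval ![x, y, u] T ^ (degreeOf 2 D - m 2) * eval ![x, y, u] T ^ m 2 := by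
      rw [← pow_add, Nat.sub_add_cancel hle]
    rw [this, div_pow]
    simp only [map_mul, map_pow, map_neg, eval_C, eval_X]
    simp only [Matrix.cons_val_zero, Matrix.cons_val_one]
    field_simp
  have hdisc : (rename ![0, 1] (s₀ * t₁ - s₁ * t₀) : MvPolynomial (Fin 3) ℂ) ≠ 0 :=
    (map_ne_zero_iff _ (rename_injective _ (by decide))).2 hs
  have hw : (rename ![0, 1] s₁ + rename ![0, 1] t₁ * X 2 : MvPolynomial (Fin 3) ℂ) ≠ 0 := by
    intro h0
    obtain ⟨p, hp⟩ := QuadCoeffs.exists_eval_ne_zero hdisc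
    have h1 := congrArg (eval ![p 0, p 1, 0]) h0
    have h2 := congrArg (eval ![p 0, p 1, 1]) h0
    simp only [map_add, map_mul, eval_X, map_zero, eval_rename_fin_two] at h1 h2
    simp only [Matrix.cons_val] at h1 h2
    rw [eta_fin_three p, eval_rename_fin_two] at hp
    simp only [map_sub, map_mul] at hp
    apply hp
    linear_combination (eval ![p 0, p 1] s₀) * (h2 - h1) - (eval ![p 0, p 1] t₀) * h1
  refine ⟨N * T, ?_, fun x y u h => ?_⟩
  -- To see `N T ≠ 0`, choose `(x, y, v)` with `D ≠ 0` first and solve the relation backwards for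
  -- `u`. The discriminant ensures that `T ≠ 0` at this `u`.
  · obtain ⟨p, hp⟩ := QuadCoeffs.exists_eval_ne_zero (mul_ne_zero (mul_ne_zero hdisc hD) hw)
    rw [eta_fin_three p] at hp
    generalize p 0 = x at hp
    generalize p 1 = y at hp
    generalize p 2 = v at hp
    simp only [map_mul, map_add, map_sub, eval_rename_fin_two, eval_X] at hp
    simp only [Matrix.cons_val] at hp
    have h3 := right_ne_zero_of_mul hp
    have h2 := right_ne_zero_of_mul (left_ne_zero_of_mul hp)
    have h1 := left_ne_zero_of_mul (left_ne_zero_of_mul hp)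
    intro h0
    obtain ⟨u, hu⟩ : ∃ u, u = -(eval ![x, y] s₀ + eval ![x, y] t₀ * v) /
      (eval ![x, y] s₁ + eval ![x, y] t₁ * v) := ⟨_, rfl⟩
    have hu' : u * (eval ![x, y] s₁ + eval ![x, y] t₁ * v) =
        -(eval ![x, y] s₀ + eval ![x, y] t₀ * v) := by rw [hu, div_mul_cancel₀ _ h3]
    have hTu : eval ![x, y, u] T ≠ 0 := by
      rw [hTe]
      intro hz
      apply h1
      linear_combination eval ![x, y] t₁ * hu' - (eval ![x, y] s₁ + eval ![x, y] t₁ * v) * hz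
    have hv : -eval ![x, y, u] S / eval ![x, y, u] T = v := by
      rw [div_eq_iff hTu, hSe, hTe]; linear_combination -hu'
    have h4 := congrArg (eval ![x, y, u]) h0
    rw [map_mul, hNe x y u hTu, hv, map_zero] at h4
    exact mul_ne_zero (mul_ne_zero (pow_ne_zero _ hTu) h2) hTu h4
  · rw [map_mul] at h
    have hTu := right_ne_zero_of_mul h
    have hNu := left_ne_zero_of_mul h
    rw [hNe x y u hTu] at hNu
    refine ⟨-eval ![x, y, u] S / eval ![x, y, u] T, fun b => ?_, H _ _ _ (right_ne_zero_of_mul hNu)⟩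
    have e : F x y u b = eval ![x, y, u] S + eval ![x, y, u] T * b := by
      rw [hF, hSe, hTe]; ring
    rw [e, eq_div_iff hTu]
    constructor
    · intro h; linear_combination h
    · intro h; linear_combination h

/-! ### Generic triples of vertices -/

theorem IsUniqueZero.congr {f g : ℂ → ℂ} {a : ℂ} (h : IsUniqueZero f a)
    (hfg : ∀ t, g t = 0 ↔ f t = 0) : IsUniqueZero g a := fun b => (hfg b).trans (h b)

theorem IsUniqueZero.eq_zero {f : ℂ → ℂ} {a : ℂ} (h : IsUniqueZero f a) : f a = 0 := (h a).2 rfl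

namespace QuadCoeffs

/-- The discriminant as a polynomial in two variables. -/
def discPoly (q : QuadCoeffs) : MvPolynomial (Fin 2) ℂ :=
  (C q.c * (X 0 * X 1) + C q.l * (X 0 + X 1) + C q.k) * (C q.c + C q.m * (X 0 * X 1))
    - (C q.a * X 0 + C q.b * X 1 + C q.l) * (C q.a * X 1 + C q.b * X 0 + C q.l)

theorem eval_discPoly (q : QuadCoeffs) (x y : ℂ) : eval ![x, y] q.discPoly = q.disc x y := by
  simp [discPoly, disc]

theorem discPoly_ne_zero {q : QuadCoeffs} (h : ∃ x y, q.disc x y ≠ 0) : q.discPoly ≠ 0 := by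
  obtain ⟨x, y, hxy⟩ := h
  intro h0
  rw [← eval_discPoly, h0, map_zero] at hxy
  exact hxy rfl

/-- At a solution the discriminant is `-Q_u Q_v`, so the slope `Q_v` cannot vanish. -/
theorem isUniqueZero_val_three {q : QuadCoeffs} {x u v y : ℂ} (h : q.disc x y ≠ 0)
    (h0 : q.val x u v y = 0) : IsUniqueZero (fun t => q.val x u t y) v := by
  refine isUniqueZero_of_slope_ne_zero (q.isAffine_val_three x u y) h0 fun hs => h ?_
  simp only [val, disc] at h0 hs ⊢
  linear_combination (q.c + q.m * (x * y)) * h0 - (q.a * x + q.b * y + q.l +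
    (q.c + q.m * (x * y)) * v) * hs

theorem isUniqueZero_val_two {q : QuadCoeffs} {x u v y : ℂ} (h : q.disc x y ≠ 0)
    (h0 : q.val x u v y = 0) : IsUniqueZero (fun t => q.val x t v y) u := by
  refine isUniqueZero_of_slope_ne_zero (q.isAffine_val_two x v y) h0 fun hs => h ?_
  simp only [val, disc] at h0 hs ⊢
  linear_combination (q.c + q.m * (x * y)) * h0 - (q.a * y + q.b * x + q.l +
    (q.c + q.m * (x * y)) * u) * hs

theorem generically_step {q : QuadCoeffs} (h : ∃ x y, q.disc x y ≠ 0) {F : ℂ → ℂ → ℂ → ℂ → ℂ}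
    (hF : ∀ x y u v, F x y u v = q.val x u v y) {P : ℂ → ℂ → ℂ → Prop} (hP : Generically P) :
    Generically fun x y u => ∃ v, IsUniqueZero (F x y u) v ∧ P x y v := by
  refine Generically.step (s₀ := C q.c * (X 0 * X 1) + C q.l * (X 0 + X 1) + C q.k)
    (s₁ := C q.a * X 0 + C q.b * X 1 + C q.l) (t₀ := C q.a * X 1 + C q.b * X 0 + C q.l)
    (t₁ := C q.c + C q.m * (X 0 * X 1)) (discPoly_ne_zero h) (fun x y u v => ?_) hP
  rw [hF]
  simp [val]; ring

theorem generically_step' {q : QuadCoeffs} (h : ∃ x y, q.disc x y ≠ 0) {F : ℂ → ℂ → ℂ → ℂ → ℂ}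
    (hF : ∀ x y u v, F x y u v = q.val x v u y) {P : ℂ → ℂ → ℂ → Prop} (hP : Generically P) :
    Generically fun x y u => ∃ v, IsUniqueZero (F x y u) v ∧ P x y v := by
  refine generically_step (q := ⟨q.b, q.a, q.c, q.l, q.k, q.m⟩) ?_ (fun x y u v => ?_) hP
  · obtain ⟨x, y, hxy⟩ := h
    refine ⟨y, x, fun h0 => hxy ?_⟩
    rw [← h0]; simp only [disc]; ring
  · rw [hF]; simp only [val]; ring

end QuadCoeffs

theorem eval_eq_of_affine {f : MvPolynomial (Fin 3) ℂ} (h0 : pderiv 0 (pderiv 0 f) = 0)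
    (h2 : pderiv 2 (pderiv 2 f) = 0) (x y z : ℂ) : eval ![x, y, z] f = eval ![0, y, 0] f +
      eval ![0, y, 0] (pderiv 0 f) * x + eval ![0, y, 0] (pderiv 2 f) * z +
      eval ![0, y, 0] (pderiv 0 (pderiv 2 f)) * (x * z) := by
  have h02 : pderiv 0 (pderiv 0 (pderiv 2 f)) = 0 := by
    rw [pderiv_comm 0 2 f, pderiv_comm 0 2, h0, map_zero]
  have u0 : Function.update ![0, y, 0] 0 x = ![x, y, 0] := by
    ext i; fin_cases i <;> simp
  have u2 : Function.update ![x, y, 0] 2 z = ![x, y, z] := by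
    ext i; fin_cases i <;> simp
  have e1 := eval_update_of_affine h2 ![x, y, 0] z
  have e2 := eval_update_of_affine h0 ![0, y, 0] x
  have e3 := eval_update_of_affine h02 ![0, y, 0] x
  rw [u2] at e1
  rw [u0] at e2 e3
  rw [e1, e2, e3]
  simp only [Matrix.cons_val]
  ring

/-- The partner of `x` with respect to a boundary polynomial is generic. -/
theorem generically_step_boundary {f : MvPolynomial (Fin 3) ℂ} (hf : Irreducible f)
    (h0 : degreeOf 0 f = 1) (h2 : degreeOf 2 f = 1) {P : ℂ → ℂ → ℂ → Prop} (hP : Generically P) :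
    Generically fun y v x => ∃ z, IsUniqueZero (fun t => eval ![x, y, t] f) z ∧ P y v z := by
  have h00 := pderiv_pderiv_of_degreeOf_le_one h0.le
  have h22 := pderiv_pderiv_of_degreeOf_le_one h2.le
  let φ : MvPolynomial (Fin 3) ℂ →ₐ[ℂ] MvPolynomial (Fin 2) ℂ := aeval ![0, X 0, 0]
  have hφ : ∀ (g : MvPolynomial (Fin 3) ℂ) (y v : ℂ), eval ![y, v] (φ g) = eval ![0, y, 0] g := by
    intro g y v
    have : (aeval ![y, v] : MvPolynomial (Fin 2) ℂ →ₐ[ℂ] ℂ).comp φ = aeval ![0, y, 0] := by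
      ext i; fin_cases i <;> simp [φ]
    have := DFunLike.congr_fun this g
    simpa [coe_aeval_eq_eval] using this
  refine Generically.step (s₀ := φ f) (s₁ := φ (pderiv 0 f)) (t₀ := φ (pderiv 2 f))
    (t₁ := φ (pderiv 0 (pderiv 2 f))) ?_ (F := fun y _ x z => eval ![x, y, z] f) ?_ hP
  · rw [← map_mul, ← map_mul, ← map_sub]
    intro hz
    -- The discriminant is free of both outer variables, so setting them to zero in `φ` does not
    -- lose its nonvanishing.
    have d0 : pderiv 0 (discr 0 2 f) = 0 := by
      have e : pderiv 0 (pderiv 0 (pderiv 2 f)) = 0 := by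
        rw [pderiv_comm 0 2 f, pderiv_comm 0 2, h00, map_zero]
      simp only [discr, map_sub, pderiv_mul, h00, e]; ring
    have d2 : pderiv 2 (discr 0 2 f) = 0 := by
      have e : pderiv 2 (pderiv 0 (pderiv 2 f)) = 0 := by rw [pderiv_comm, h22, map_zero]
      simp only [discr, map_sub, pderiv_mul, h22, e, pderiv_comm 2 0 f]; ring
    obtain ⟨p, hp⟩ := QuadCoeffs.exists_eval_ne_zero (discr_ne_zero_of_degreeOf hf h0 h2)
    apply hp
    have e1 := eval_update_of_pderiv_eq_zero d0 p 0
    have e2 := eval_update_of_pderiv_eq_zero d2 (Function.update p 0 0) 0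
    rw [← e1, ← e2]
    have u : Function.update (Function.update p 0 0) 2 0 = ![0, p 1, 0] := by
      ext i; fin_cases i <;> simp [Function.update]
    rw [u, ← hφ _ _ 0]
    exact (congrArg _ hz).trans (map_zero _)
  · intro y v x z
    simp only [hφ]
    exact eval_eq_of_affine h00 h22 x y z

/-- Passage from the initial values `x, y, u` to the vertices `z, w, v`. -/
theorem generically_right {E : BulkType} {f : MvPolynomial (Fin 3) ℂ} (hf : Irreducible f)
    (h0 : degreeOf 0 f = 1) (h2 : degreeOf 2 f = 1) {α β l : ℂ} (hα : E.Regular α l)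
    (hβ : E.Regular β l) {P : ℂ → ℂ → ℂ → Prop} (hP : Generically P) :
    Generically fun x y u => ∃ v, IsUniqueZero (fun t => E.Q x y u t α l) v ∧
      ∃ z, IsUniqueZero (fun t => eval ![x, y, t] f) z ∧
      ∃ w, IsUniqueZero (fun t => E.Q y z v t β l) w ∧ P z w v := by
  -- The condition on the final triple is pulled back vertex by vertex, in reverse order: first `w`,
  -- then `z`, then `v`. The swaps bring the variable to be replaced into third place.
  have s1 : Generically fun z v y => ∃ w, IsUniqueZero (fun t => E.Q y z v t β l) w ∧ P z w v :=
    QuadCoeffs.generically_step (QuadCoeffs.exists_disc_ne_zero hβ.irreducible)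
      (fun z v y w => by rw [BulkType.Q_swap_horizontal, BulkType.Q_eq]) hP.swap_last
  have s2 := (generically_step_boundary hf h0 h2 s1.swap_outer).swap_outer.swap_last
  exact QuadCoeffs.generically_step' (QuadCoeffs.exists_disc_swapUY_ne_zero hα.irreducible)
    (fun x y u v => by
      rw [BulkType.Q_eq]; simp only [QuadCoeffs.val, QuadCoeffs.swapUY]; ring) s2

/-- Passage from the initial values `x, y, u` to the vertices `r, s, v`. -/
theorem generically_left {E : BulkType} {f : MvPolynomial (Fin 3) ℂ} (hf : Irreducible f)
    (h0 : degreeOf 0 f = 1) (h2 : degreeOf 2 f = 1) {α l η : ℂ} (hα : E.Regular α l)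
    (hη : E.Regular α η) {P : ℂ → ℂ → ℂ → Prop} (hP : Generically P) :
    Generically fun x y u => ∃ v, IsUniqueZero (fun t => E.Q x y u t α l) v ∧
      ∃ r, IsUniqueZero (fun t => eval ![x, u, t] f) r ∧
      ∃ s, IsUniqueZero (fun t => E.Q u v r t α η) s ∧ P r s v := by
  have s1 : Generically fun r v u => ∃ s, IsUniqueZero (fun t => E.Q u v r t α η) s ∧ P r s v :=
    QuadCoeffs.generically_step' (QuadCoeffs.exists_disc_ne_zero hη.irreducible)
      (fun r v u s => by rw [BulkType.Q_swap_vertical, BulkType.Q_eq]) hP.swap_last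
  have s2 := (generically_step_boundary hf h0 h2 s1.swap_outer).swap_outer.swap_last
  have s3 := QuadCoeffs.generically_step (F := fun x u y v => E.Q x y u v α l)
    (QuadCoeffs.exists_disc_swapVY_ne_zero hα.irreducible)
    (fun x u y v => by
      rw [BulkType.Q_eq]; simp only [QuadCoeffs.val, QuadCoeffs.swapVY]; ring) s2
  exact s3.swap_last

theorem generically_disc {q : QuadCoeffs} (h : ∃ x y, q.disc x y ≠ 0) :
    Generically fun x y _ => q.disc x y ≠ 0 := by
  refine (Generically.of_eval_ne_zero (D := rename ![0, 1] q.discPoly) ?_).mono fun x y u hu => ?_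
  · exact (map_ne_zero_iff _ (rename_injective _ (by decide))).2 (QuadCoeffs.discPoly_ne_zero h)
  · rwa [eval_rename_fin_two, QuadCoeffs.eval_discPoly] at hu

/-! ### The two configurations of faces -/

namespace BulkType

theorem Good.neg {E : BulkType} (hE : E.tetrahedron = E) {α β : ℂ} (h : E.Good α β) :
    E.Good (-α) (-β) := by
  have e : -α - -β = -(α - β) := by ring
  cases E <;> simp only [tetrahedron, reduceCtorEq] at hE <;>
    simp only [Good, e, Complex.sinh_neg, jacobiSn_neg, neg_ne_zero] at h ⊢
  case Q4 τ => exact ⟨⟨h.1.1.neg, h.1.2.1.neg, h.1.2.2.neg⟩, h.2⟩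
  all_goals exact h

/-- Four faces at a common vertex `v` whose outer vertices `r` and `z` coincide. -/
theorem Q_eq_zero_of_four_faces (E : BulkType) {α β l η : ℂ} (hsum : α + β = l + η)
    (hαl : E.Good α l) (hβl : E.Good β l) (hαη : E.Good α η) (hβη : E.Good β η)
    (hαβ : E.Good α β) {x y z u v w s : ℂ} (h1 : E.Q x y u v α l = 0)
    (h2 : E.Q y z v w β l = 0) (hs : IsUniqueZero (fun t => E.Q u v z t α η) s) :
    E.Q v w s x β η = 0 := by
  -- Both pairs of faces at `v` are compared with the same auxiliary face through `u, v, w`,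
  -- carrying `α, β`. Its fourth vertex is eliminated and need not exist.
  obtain ⟨κ, κ', -, h0, H⟩ := E.exists_affRes_tetrahedron hαl hβl.comm hαβ
  obtain ⟨ι, ι', i0, -, I⟩ := E.exists_affRes_tetrahedron hαη hβη.comm hαβ
  have e1 : affRes (fun t => E.Q v u t x α l) (fun t => E.Q v t w z l β) = 0 := by
    refine affRes_eq_zero (E.isAffine_Q_three _ _ _ _ _) (E.isAffine_Q_two _ _ _ _ _) (t := y) ?_ ?_
    · rw [← h1]; exact E.Q_reverse ..
    · show E.Q v y w z l β = 0
      rw [Q_swap_horizontal, Q_swap_parameters, h2, neg_zero]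
  have e2 := H v u w x z
  rw [e1, mul_zero, eq_comm, mul_eq_zero, or_iff_right h0] at e2
  -- The involution enters here: the two tetrahedron equations agree after exchanging the parameters
  -- and changing their signs.
  have e3 : (fun t => E.tetrahedron.Q v z x t (α - η) (β - η)) =
      fun t => E.tetrahedron.Q v x z t (α - l) (β - l) := by
    funext t
    rw [Q_swap_parameters, ← Q_neg_parameters E.tetrahedron_tetrahedron]
    congr 1 <;> linear_combination -hsum
  have e4 := I v u w z x
  rw [e3, e2, mul_zero, mul_eq_zero, or_iff_right i0] at e4
  have hs' : IsUniqueZero (fun t => E.Q v u t z α η) s :=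
    hs.congr fun t => by rw [Q_swap_horizontal]
  have e5 := eq_zero_of_affRes (E.isAffine_Q_three _ _ _ _ _) (E.isAffine_Q_two _ _ _ _ _) e4 hs'.eq_zero
    (hs'.slope_ne_zero (E.isAffine_Q_three _ _ _ _ _))
  rw [Q_swap_parameters, e5, neg_zero]

end BulkType

/-- Three faces at a common vertex `v` lead to a solution of the tetrahedron equation. -/
theorem BulkType.tetrahedron_eq_zero_of_faces (E : BulkType) {α β γ : ℂ} (hαβ : E.Good α β)
    (hβγ : E.Good β γ) (hαγ : E.Good α γ) {v u₁ u₃ x y s t : ℂ} (h1 : E.Q v u₁ t x α β = 0)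
    (h2 : E.Q v t u₃ y β γ = 0) (hs : IsUniqueZero (fun t => E.Q v u₁ u₃ t α γ) s) :
    E.tetrahedron.Q v x y s (α - β) (γ - β) = 0 := by
  obtain ⟨κ, κ', -, h0, H⟩ := E.exists_affRes_tetrahedron hαβ hβγ hαγ
  have e := H v u₁ u₃ x y
  rw [affRes_eq_zero (E.isAffine_Q_three _ _ _ _ _) (E.isAffine_Q_two _ _ _ _ _) h1 h2, mul_zero,
    eq_comm, mul_eq_zero, or_iff_right h0] at e
  exact eq_zero_of_affRes (E.isAffine_Q_four _ _ _ _ _) (E.tetrahedron.isAffine_Q_four _ _ _ _ _) e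
    hs.eq_zero (hs.slope_ne_zero (E.isAffine_Q_four _ _ _ _ _))

/-! ### Möbius transformations -/

namespace MobiusForm

/-- The relation between two vertices that is given by the boundary polynomial. -/
def rel : MobiusForm → ℂ → ℂ → ℂ
  | .plus r₁ r₂ r₄ _, x, y => r₁ * x * y + r₂ * x + r₂ * y + r₄
  | .minus, x, y => x - y

theorem eval_poly (M : MobiusForm) (x t y : ℂ) : eval ![x, t, y] M.poly = M.rel x y := by
  cases M <;> simp [poly, rel]

/-- The Möbius map is an involution: its matrix has trace zero in the plus case and is the identity
in the minus case. -/
theorem rel_symm {M : MobiusForm} {x y : ℂ} (h : M.rel x y = 0) : M.rel y x = 0 := by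
  cases M <;> simp only [rel] at h ⊢
  · linear_combination h
  · linear_combination -h

/-- The denominator of the associated Möbius transformation. -/
def den (M : MobiusForm) (x : ℂ) : ℂ := M.matrix 1 0 * x + M.matrix 1 1

theorem den_ne_zero {M : MobiusForm} {x y : ℂ} (h : M.rel x y = 0) : M.den x ≠ 0 := by
  cases M with
  | minus => simp [den, matrix]
  | plus r₁ r₂ r₄ hr =>
    simp only [rel] at h
    simp only [den, matrix, Matrix.cons_val, Matrix.of_apply]
    intro h0
    apply hr
    linear_combination r₁ * h - (r₂ + r₁ * y) * h0

theorem rel_eq_zero_iff {M : MobiusForm} {x : ℂ} (hx : M.den x ≠ 0) (y : ℂ) :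
    M.rel x y = 0 ↔ y = mobius M.matrix x := by
  rw [mobius, eq_div_iff (by exact hx)]
  cases M <;> simp only [rel, matrix, Matrix.cons_val, Matrix.of_apply, Matrix.one_apply]
  · constructor <;> intro h <;> linear_combination h
  · constructor <;> intro h
    · simp; linear_combination -h
    · simp at h; linear_combination -h

theorem eq_mobius {M : MobiusForm} {x y : ℂ} (h : M.rel x y = 0) : y = mobius M.matrix x :=
  (rel_eq_zero_iff (den_ne_zero h) y).1 h

theorem isUniqueZero_rel {M : MobiusForm} {x y : ℂ} (h : M.rel x y = 0) :
    IsUniqueZero (M.rel x) y := fun b => by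
  rw [rel_eq_zero_iff (den_ne_zero h), ← eq_mobius h]

theorem generically_den_ne_zero (M : MobiusForm) : Generically fun _ y _ => M.den y ≠ 0 := by
  obtain ⟨x, hx⟩ : ∃ x, M.den x ≠ 0 := by
    cases M with
    | minus => exact ⟨0, by simp [den, matrix]⟩
    | plus r₁ r₂ r₄ hr =>
      by_contra! h
      have h0 := h 0
      have h1 := h 1
      simp [den, matrix] at h0 h1
      simp [h0] at h1
      simp [h0, h1] at hr
  refine (Generically.of_eval_ne_zero
    (D := C (M.matrix 1 0) * X 1 + C (M.matrix 1 1)) fun h => hx ?_).mono fun x y u h => ?_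
  · have := congrArg (eval ![0, x, 0]) h
    simpa [den] using this
  · simpa [den] using h

/-- The partner of a vertex with respect to the Möbius transformation is generic. -/
theorem generically_step_rel (M : MobiusForm) {P : ℂ → ℂ → ℂ → Prop} (hP : Generically P) :
    Generically fun x y u => ∃ n, M.rel u n = 0 ∧ P x y n := by
  have : Generically fun x y u => ∃ n, IsUniqueZero (M.rel u) n ∧ P x y n := by
    cases M with
    | minus =>
      exact Generically.step (s₀ := 0) (s₁ := 1) (t₀ := -1) (t₁ := 0) (by simp)
        (F := fun _ _ u n => u - n) (fun x y u n => by simp; ring) hP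
    | plus r₁ r₂ r₄ hr =>
      refine Generically.step (s₀ := C r₄) (s₁ := C r₂) (t₀ := C r₂) (t₁ := C r₁) ?_
        (F := fun _ _ u n => r₁ * u * n + r₂ * u + r₂ * n + r₄) (fun x y u n => by simp; ring) hP
      rw [← map_mul, ← map_mul, ← map_sub]
      exact C_ne_zero.2 fun h => hr (by linear_combination h)
  exact this.mono fun x y u ⟨n, h, hn⟩ => ⟨n, h.eq_zero, hn⟩

end MobiusForm

theorem IsMobiusSymmetry.Q_eq_zero {E : BulkType} {M : MobiusForm} (h : IsMobiusSymmetry E M.matrix)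
    {α β : ℂ} (hαβ : E.Regular α β) {x u v y x' u' v' y' : ℂ} (hx : M.rel x x' = 0)
    (hu : M.rel u u' = 0) (hv : M.rel v v' = 0) (hy : M.rel y y' = 0) (h0 : E.Q x u v y α β = 0) :
    E.Q x' u' v' y' α β = 0 := by
  rw [MobiusForm.eq_mobius hx, MobiusForm.eq_mobius hu, MobiusForm.eq_mobius hv,
    MobiusForm.eq_mobius hy]
  exact h.2 α β hαβ x u v y (MobiusForm.den_ne_zero hx) (MobiusForm.den_ne_zero hu)
    (MobiusForm.den_ne_zero hv) (MobiusForm.den_ne_zero hy) h0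

/-- A solution of the boundary equation extends to a face on which the dual boundary equation
holds. -/
theorem IsDualPair.Q_eq_zero {E : BulkType} {q p : TriFamily} (h : IsDualPair E q p)
    {M : MobiusForm} (hM : M.Has E p) {α β : ℂ} (hαβ : E.Regular α β) {x u n y : ℂ}
    (hn : M.rel u n = 0) (hy : IsUniqueZero (fun t => eval ![x, u, t] (q α β)) y) :
    E.Q x u n y α β = 0 := by
  obtain ⟨hq, -, χ, hχ⟩ := h
  obtain ⟨-, -, hq2⟩ := hq.1 α β hαβ
  have h22 := pderiv_pderiv_of_degreeOf_le_one hq2.le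
  have e := congrArg (eval ![x, u, n, y]) (hχ α β hαβ)
  have e3 : pderiv 3 (onXUY (q α β)) = rename ![0, 1, 3] (pderiv 2 (q α β)) :=
    pderiv_rename injective_xuy 2 _
  have c : ![x, u, n, y] ∘ ![0, 1, 3] = ![x, u, y] := by
    ext i; fin_cases i <;> rfl
  have c' : ![x, u, n, y] ∘ ![1, 0, 2] = ![u, x, n] := by
    ext i; fin_cases i <;> rfl
  rw [eliminant, e3, hM α β hαβ, onXUY, onUXV] at e
  simp only [map_sub, map_mul, eval_rename, c, c', MobiusForm.eval_poly, hn, mul_zero,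
    hy.eq_zero, sub_zero] at e
  -- Since `p` and `q` vanish, the duality relation leaves `Q q_y = 0`. Uniqueness of `y` excludes
  -- `q_y = 0`.
  refine (mul_eq_zero.1 e).resolve_right fun h0 => ?_
  have e1 := eval_update_of_affine h22 ![x, u, y] (y + 1)
  have c1 : Function.update ![x, u, y] 2 (y + 1) = ![x, u, y + 1] := by
    ext i; fin_cases i <;> simp
  rw [c1, h0, mul_zero, add_zero, hy.eq_zero] at e1
  simpa using (hy (y + 1)).1 e1

/-- Six faces with Möbius related vertices, on one side of the final face. -/
theorem BulkType.Q_eq_zero_of_mobius (E : BulkType) {M : MobiusForm}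
    (hM : IsMobiusSymmetry E.tetrahedron M.matrix) {α β l η : ℂ} (hsum : α + β = l + η)
    (hαl : E.Good α l) (hβl : E.Good β l) (hαη : E.Good α η) (hβη : E.Good β η)
    (hαβ : E.Good α β) (hlη : E.Good l η) {x y z u v w r s t n m k : ℂ} (hn : M.rel y n = 0)
    (hm : M.rel u m = 0) (hk : M.rel s k = 0) (h1 : E.Q x y u v α l = 0)
    (h2 : E.Q x y n z α β = 0) (h3 : E.Q x u m r l η = 0)
    (hw : IsUniqueZero (fun t => E.Q y z v t β l) w)
    (hs : IsUniqueZero (fun t => E.Q u v r t α η) s) (h4 : E.Q r s k t α β = 0)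
    (hd : (E.tetrahedron.coeffs (α - l) (η - l)).disc u n ≠ 0)
    (hv : IsUniqueZero (fun t => E.Q u t r s α η) v) : E.Q v w s t β η = 0 := by
  have hE := E.tetrahedron_tetrahedron
  have k1 : E.tetrahedron.Q u y m s (α - l) (η - l) = 0 :=
    E.tetrahedron_eq_zero_of_faces hαl hlη hαη (t := x) (by rw [← h1]; exact E.Q_swap_vertical ..)
      (by rw [← h3]; exact E.Q_swap_horizontal ..) hs
  have k2 : E.tetrahedron.Q y n u w (β - α) (l - α) = 0 :=
    E.tetrahedron_eq_zero_of_faces hαβ.comm hαl hβl (t := x)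
      (by rw [Q_swap_vertical, Q_swap_parameters, h2, neg_zero])
      (by rw [← h1]; exact E.Q_swap_horizontal ..) hw
  -- The symmetry reflects all four vertices of `k1`; `m` returns to `u` by involutivity.
  have k3 : E.tetrahedron.Q m n u k (α - l) (η - l) = 0 :=
    hM.Q_eq_zero (hαl.regular_tetrahedron hlη hαη) hm hn (MobiusForm.rel_symm hm) hk k1
  have p1 : α - l + (η - α) = η - l := by ring
  have p2 : α - l - (η - α) = α - β := by linear_combination hsum
  have g1 : E.tetrahedron.Good (α - l) (α - l + (η - α)) := by
    rw [p1]; exact (hαl.regular_tetrahedron hlη hαη).good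
  have g2 : E.tetrahedron.Good (α - l) (α - l - (η - α)) := by
    have := (hαl.comm.regular_tetrahedron hαβ hβl.comm).good.neg hE
    rwa [neg_sub, neg_sub, ← p2] at this
  -- The equations `k1` and `k2` share the vertex `y`. Exchanging `s` and `n` in the resultant
  -- replaces `y` by `k`, already fixed by `k3`.
  have k4 := affRes_symm_of_involution hE g2 g1 u m s w n
  rw [p1, p2, affRes_eq_zero (E.tetrahedron.isAffine_Q_two _ _ _ _ _)
    (E.tetrahedron.isAffine_Q_two _ _ _ _ _) k1
    (by rw [← neg_sub l α, ← neg_sub β α, Q_neg_parameters hE, Q_swap_horizontal,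
      Q_swap_parameters, k2, neg_zero, neg_zero]), eq_comm] at k4
  have k3' : E.tetrahedron.Q u k m n (α - l) (η - l) = 0 := by
    rw [← k3]; exact E.tetrahedron.Q_swap_vertical ..
  have huk : IsUniqueZero (fun t => E.tetrahedron.Q u t m n (α - l) (η - l)) k := by
    simp only [Q_eq] at k3' ⊢
    exact QuadCoeffs.isUniqueZero_val_two hd k3'
  have k5 := eq_zero_of_affRes (E.tetrahedron.isAffine_Q_two _ _ _ _ _)
    (E.tetrahedron.isAffine_Q_two _ _ _ _ _) k4 k3'
    (huk.slope_ne_zero (E.tetrahedron.isAffine_Q_two _ _ _ _ _))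
  have k6 : E.tetrahedron.Q s u w k (α - η) (β - η) = 0 := by
    have e1 : α - β = α - l - (β - l) := by ring
    have e2 : α - l = -(β - η) := by linear_combination hsum
    have e3 : β - l = -(α - η) := by linear_combination hsum
    rw [e1, Q_swap_last hE, e2, e3, Q_neg_parameters hE, Q_swap_parameters, neg_neg,
      Q_swap_horizontal] at k5
    exact k5
  obtain ⟨κ, κ', h0, -, H⟩ := E.exists_affRes_tetrahedron hαη hβη.comm hαβ
  -- At `s`, the face through `r, k, t` and the tetrahedron equation `k6` share `k`. The tetrahedron
  -- property turns this into two faces sharing `v`, one of which is the face sought.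
  have e := H s r t u w
  rw [affRes_eq_zero (E.isAffine_Q_four _ _ _ _ _) (E.tetrahedron.isAffine_Q_four _ _ _ _ _)
    (t := k) (by rw [← h4]; exact E.Q_swap_horizontal ..) k6, mul_zero, mul_eq_zero,
    or_iff_right h0] at e
  have hv' : IsUniqueZero (fun t => E.Q s r t u α η) v := hv.congr fun t => by rw [Q_reverse]
  have e5 := eq_zero_of_affRes (E.isAffine_Q_three _ _ _ _ _) (E.isAffine_Q_two _ _ _ _ _) e
    hv'.eq_zero (hv'.slope_ne_zero (E.isAffine_Q_three _ _ _ _ _))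
  rw [Q_swap_parameters, Q_swap_horizontal, e5, neg_zero]

/-! ### Boundary consistency -/

theorem IsUniqueZero.unique {f : ℂ → ℂ} {a b : ℂ} (h : IsUniqueZero f a) (h' : IsUniqueZero f b) :
    b = a := (h b).1 h'.eq_zero

/-- The entry `u` is arbitrary: the derivative does not depend on it, and one Newton step from `u`
reaches the root. -/
theorem exists_isUniqueZero_of_pderiv_ne_zero {f : MvPolynomial (Fin 3) ℂ}
    (h2 : degreeOf 2 f = 1) {x y u : ℂ} (h : eval ![x, y, u] (pderiv 2 f) ≠ 0) :
    ∃ t, IsUniqueZero (fun t => eval ![x, y, t] f) t := by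
  refine ⟨u - eval ![x, y, u] f / eval ![x, y, u] (pderiv 2 f), fun b => ?_⟩
  have e := eval_update_of_affine (pderiv_pderiv_of_degreeOf_le_one h2.le) ![x, y, u] b
  have c : Function.update ![x, y, u] 2 b = ![x, y, b] := by
    ext i; fin_cases i <;> simp
  have c' : ![x, y, u] 2 = u := rfl
  rw [c, c'] at e
  have c2 : eval ![x, y, u] f = eval ![x, y, u] f / eval ![x, y, u] (pderiv 2 f) *
    eval ![x, y, u] (pderiv 2 f) := (div_mul_cancel₀ _ h).symm
  beta_reduce
  rw [e]
  constructor <;> intro h1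
  · apply mul_right_cancel₀ h
    linear_combination h1 - c2
  · rw [h1]; linear_combination c2

theorem BulkType.isUniqueZero_Q_four {E : BulkType} {α β x u v y : ℂ}
    (h : (E.coeffs α β).swapUY.disc x u ≠ 0) (h0 : E.Q x u v y α β = 0) :
    IsUniqueZero (fun t => E.Q x u v t α β) y := by
  have e : ∀ t, E.Q x u v t α β = (E.coeffs α β).swapUY.val x t v u := fun t => by
    rw [Q_eq]; simp only [QuadCoeffs.val, QuadCoeffs.swapUY]; ring
  simp only [e] at h0 ⊢
  exact QuadCoeffs.isUniqueZero_val_two h h0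

theorem BulkType.isUniqueZero_Q_two {E : BulkType} {α β x u v y : ℂ}
    (h : (E.coeffs α β).swapUY.disc v y ≠ 0) (h0 : E.Q x u v y α β = 0) :
    IsUniqueZero (fun t => E.Q x t v y α β) u := by
  have e : ∀ t, E.Q x t v y α β = (E.coeffs α β).swapUY.val v t x y := fun t => by
    rw [Q_eq]; simp only [QuadCoeffs.val, QuadCoeffs.swapUY]; ring
  simp only [e] at h0 ⊢
  exact QuadCoeffs.isUniqueZero_val_two h h0

theorem BulkType.isUniqueZero_Q_three {E : BulkType} {α β x u v y : ℂ}
    (h : (E.coeffs α β).swapVY.disc u y ≠ 0) (h0 : E.Q x u v y α β = 0) :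
    IsUniqueZero (fun t => E.Q x u t y α β) v := by
  have e : ∀ t, E.Q x u t y α β = (E.coeffs α β).swapVY.val u x t y := fun t => by
    rw [Q_eq]; simp only [QuadCoeffs.val, QuadCoeffs.swapVY]; ring
  simp only [e] at h0 ⊢
  exact QuadCoeffs.isUniqueZero_val_three h h0

theorem BulkType.Regular.generically_disc_swapUY {E : BulkType} {α β : ℂ} (h : E.Regular α β) :
    Generically fun x y _ => (E.coeffs α β).swapUY.disc x y ≠ 0 :=
  generically_disc (QuadCoeffs.exists_disc_swapUY_ne_zero h.irreducible)

theorem BulkType.Regular.generically_disc_swapVY {E : BulkType} {α β : ℂ} (h : E.Regular α β) :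
    Generically fun x y _ => (E.coeffs α β).swapVY.disc x y ≠ 0 :=
  generically_disc (QuadCoeffs.exists_disc_swapVY_ne_zero h.irreducible)

/-- Well-posedness if the boundary equation itself is given by a Möbius transformation. -/
theorem wellPosed_of_mobius {E : BulkType} {q : TriFamily} (hq : IsBoundaryPolynomial E q)
    {M : MobiusForm} (hM : M.Has E q) {α β l η : ℂ} (hsum : α + β = l + η)
    (hαl : E.Regular α l) (hβl : E.Regular β l) (hαη : E.Regular α η) (hβη : E.Regular β η)
    (hαβ : E.Regular α β) (hlη : E.Regular l η) : HalfDodecahedronWellPosed E q α β l η := by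
  obtain ⟨i1, d1, d1'⟩ := hq.1 α β hαβ
  obtain ⟨i2, d2, d2'⟩ := hq.1 l η hlη
  have G := (generically_right i1 d1 d1' hαl hβl hβη.generically_disc_swapUY.swap_outer).and
    (generically_left i2 d2 d2' hαl hαη (Generically.of_eval_ne_zero one_ne_zero))
  refine G.mono fun x y u ⟨⟨v, hv, z, hz, w, hw, hd⟩, v', hv', r, hr, s, hs, _⟩ => ?_
  obtain rfl := hv.unique hv'
  simp only [TriFamily.val, hM α β hαβ, hM l η hlη, MobiusForm.eval_poly] at hz hr ⊢
  -- Both outer vertices are the Möbius partner of `x`. The last value is then `x` itself, by the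
  -- symmetry of the relation.
  obtain rfl := hr.unique hz
  have ht : E.Q v' w s x β η = 0 :=
    E.Q_eq_zero_of_four_faces hsum hαl.good hβl.good hαη.good hβη.good hαβ.good hv.eq_zero
      hw.eq_zero hs
  have hx := MobiusForm.isUniqueZero_rel (MobiusForm.rel_symm hz.eq_zero)
  exact ⟨z, z, v', w, s, x, hz, hz, hv, hw, hs, BulkType.isUniqueZero_Q_four hd ht, hx, hx⟩

/-- Well-posedness if the dual boundary equation is given by a Möbius transformation that is a
symmetry of the tetrahedron equation. -/
theorem wellPosed_of_dual_mobius {E : BulkType} {q p : TriFamily} (hqp : IsDualPair E q p)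
    {M : MobiusForm} (hM : M.Has E p) (hS : IsMobiusSymmetry E.tetrahedron M.matrix)
    {α β l η : ℂ} (hsum : α + β = l + η)
    (hαl : E.Regular α l) (hβl : E.Regular β l) (hαη : E.Regular α η) (hβη : E.Regular β η)
    (hαβ : E.Regular α β) (hlη : E.Regular l η) : HalfDodecahedronWellPosed E q α β l η := by
  obtain ⟨i1, d1, d1'⟩ := hqp.1.1 α β hαβ
  obtain ⟨i2, d2, d2'⟩ := hqp.1.1 l η hlη
  have T1 : E.tetrahedron.Regular (α - l) (η - l) :=
    hαl.good.regular_tetrahedron hlη.good hαη.good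
  have T2 : E.tetrahedron.Regular (l - α) (β - α) :=
    hαl.good.comm.regular_tetrahedron hαβ.good hβl.good.comm
  -- `A` and `B` provide the reflections `n` of `y` and `m` of `u`, with the discriminants at `(u,
  -- n)` and `(y, m)` nonzero, as required by the two uses of `BulkType.Q_eq_zero_of_mobius`.
  have A := ((M.generically_step_rel
    (generically_disc (QuadCoeffs.exists_disc_ne_zero T1.irreducible)).swap_last).swap_last).swap_outer
  have B := (M.generically_step_rel
    (generically_disc (QuadCoeffs.exists_disc_ne_zero T2.irreducible)).swap_last).swap_first
  have R := generically_right i1 d1 d1' hαl hβl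
    ((hβη.generically_disc_swapUY.swap_outer.and hβl.generically_disc_swapVY).and
      (M.generically_den_ne_zero.and (Generically.of_eval_ne_zero
        (IsBoundaryPolynomial.pderiv_ne_zero d2'))))
  have L := generically_left i2 d2 d2' hαl hαη
    (hαη.generically_disc_swapUY.and (M.generically_den_ne_zero.and (Generically.of_eval_ne_zero
        (IsBoundaryPolynomial.pderiv_ne_zero d1'))))
  refine ((A.and B).and (R.and L)).mono fun x y u ⟨⟨⟨n, hn, hdn⟩, m, hm, hdm⟩,
    ⟨v, hv, z, hz, w, hw, ⟨hD, hD1⟩, hwd, hqw⟩, v', hv', r, hr, s, hs, hD2, hsd, hqs⟩ => ?_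
  obtain rfl := hv.unique hv'
  obtain ⟨k, hk⟩ : ∃ k, k = mobius M.matrix s := ⟨_, rfl⟩
  obtain ⟨k', hk'⟩ : ∃ k, k = mobius M.matrix w := ⟨_, rfl⟩
  rw [← MobiusForm.rel_eq_zero_iff hsd] at hk
  rw [← MobiusForm.rel_eq_zero_iff hwd] at hk'
  obtain ⟨t, ht⟩ := exists_isUniqueZero_of_pderiv_ne_zero d1' hqs
  obtain ⟨t', ht'⟩ := exists_isUniqueZero_of_pderiv_ne_zero d2' hqw
  have z1 := hqp.Q_eq_zero hM hαβ hn hz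
  have z2 := hqp.Q_eq_zero hM hlη hm hr
  have e1 : E.Q v' w s t β η = 0 :=
    E.Q_eq_zero_of_mobius hS hsum hαl.good hβl.good hαη.good hβη.good hαβ.good hlη.good hn hm hk
      hv.eq_zero z1 z2 hw hs (hqp.Q_eq_zero hM hαβ hk ht) hdn
      (BulkType.isUniqueZero_Q_two hD2 hs.eq_zero)
  -- The mirror image of `e1`: `α, β, y, z, w` are interchanged with `l, η, u, r, s`.
  have e2 : E.Q v' s w t' η β = 0 :=
    E.Q_eq_zero_of_mobius (α := l) (l := α) (β := η) (η := β) hS hsum.symm hαl.good.comm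
      hαη.good.comm hβl.good.comm hβη.good.comm hlη.good hαβ.good hm hn hk'
      (by rw [BulkType.Q_swap_parameters, hv.eq_zero, neg_zero]) z2 z1
      (hs.congr fun t => by rw [BulkType.Q_swap_parameters, neg_eq_zero])
      (hw.congr fun t => by rw [BulkType.Q_swap_parameters, neg_eq_zero])
      (hqp.Q_eq_zero hM hlη hk' ht') hdm
      ((BulkType.isUniqueZero_Q_three hD1 hw.eq_zero).congr fun t => by
        rw [BulkType.Q_swap_parameters, neg_eq_zero])
  have e3 := BulkType.isUniqueZero_Q_four hD e1
  have e4 : t' = t := (e3 t').1 (by beta_reduce; rw [BulkType.Q_swap_parameters, e2, neg_zero])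
  rw [e4] at ht'
  exact ⟨z, r, v', w, s, t, hz, hr, hv, hw, hs, e3, ht, ht'⟩

end

end QuadGraph

theorem theorem3p3 (E : QuadGraph.BulkType) (q p : QuadGraph.TriFamily)
    (hqp : QuadGraph.IsDualPair E q p) (M : QuadGraph.MobiusForm) (μ : ℂ) :
    (M.Has E q → QuadGraph.BoundaryConsistent E q (fun α => -α + μ)) ∧
    (M.Has E p → QuadGraph.IsMobiusSymmetry E.tetrahedron M.matrix →
      QuadGraph.BoundaryConsistent E q (fun α => -α + μ)) := by
  refine ⟨fun hM => ⟨fun α => by ring, QuadGraph.nondegenerate_of_isDualPair hqp,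
    fun α l h1 h2 h3 h4 h5 h6 => ?_⟩, fun hM hS => ⟨fun α => by ring,
    QuadGraph.nondegenerate_of_isDualPair hqp, fun α l h1 h2 h3 h4 h5 h6 => ?_⟩⟩
  -- Both `α + σ α` and `l + σ l` equal `μ`.
  · exact QuadGraph.wellPosed_of_mobius hqp.1 hM (by ring) h1 h2 h3 h4 h5 h6
  · exact QuadGraph.wellPosed_of_dual_mobius hqp hM hS (by ring) h1 h2 h3 h4 h5 h6
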